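/- Let $n\ge 2$, $G=\mathbb{Z}_n$, and let $\rho$ be a faithful one-dimensional unitary representation of $G$. On the lattice $\mathbb{Z}^4$ let $B_N=[-N,N]^4\cap\mathbb{Z}^4$, and let $C_k(B_N)$ be the set of oriented $k$-cells of $B_N$, each cell taken with both orientations. Let $\Omega^k(B_N,G)$ be the set of $G$-valued $k$-forms on $B_N$, i.e. functions $\omega:C_k(B_N)\to G$ with $\omega(-c)=-\omega(c)$, extended to $k$-chains by linearity, and let $d\sigma(p)=\sigma(\partial p)$ for $\sigma\in\Omega^1(B_N,G)$ and $p\in C_2(B_N)$. For $\beta,\kappa\ge 0$ consider on $\Omega^1(B_N,G)\times\Omega^0(B_N,G)$ the probability measure $$\mu_{N,\beta,\kappa,\infty}(\sigma,\phi)\ \propto\ \exp\Bigl(\beta\sum_{p\in C_2(B_N)}\rho\bigl(d\sigma(p)\bigr)+\kappa\sum_{e\in C_1(B_N)}\rho\bigl(\sigma(e)-\phi(\partial e)\bigr)\Bigr),$$ and for $\beta=\infty$ the probability measure $\mu_{N,\infty,\kappa,\infty}(\sigma,\phi)\propto \mathbf 1_{\{d\sigma=0\}}\exp\bigl(\kappa\sum_{e\in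 C_1(B_N)}\rho(\sigma(e)-\phi(\partial e))\bigr)$. A path is a finitely supported $1$-chain $\gamma$ on $\mathbb{Z}^4$ with coefficients in $\{-1,0,1\}$ such that $\partial\gamma=0$ or $\partial\gamma=x_2-x_1$ for some $x_1,x_2\in\mathbb{Z}^4$. Its support $\operatorname{supp}\gamma$ is the set of positively oriented edges with non-zero coefficient, and the Wilson line observable is $L_\gamma(\sigma,\phi)=\rho\bigl(\sigma(\gamma)-\phi(\partial\gamma)\bigr)$. For $\beta\in[0,\infty]$ write $\langle L_\gamma(\sigma,\phi)\rangle_{\beta,\kappa,\infty}=\lim_{N\to\infty}\mathbb{E}_{N,\beta,\kappa,\infty}[L_\gamma(\sigma,\phi)]$. For $r\ge0$ let $\varphi_r(g)=e^{r\operatorname{Re}(\rho(g)-\rho(0))}$ and $$\alpha_0(r)=\sum_{g\in G\setminus\{0\}}\varphi_r(g)^2,\qquad \alpha_1(r)=\max_{g\in G\setminus\{0\}}\varphi_r(g)^2 .$$ Proposition. Let $\beta,\kappa\in[0,\infty)$ be such that $18^2\alpha_0(\kappa)\bigl(2+\alpha_0(\kappa)\bigr)<1$, and let $\gamma$ be a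 path. Then the limits $\langle L_\gamma(\sigma,\phi)\rangle_{\beta,\kappa,\infty}$ and $\langle L_\gamma(\sigma,\phi)\rangle_{\infty,\kappa,\infty}$ exist, and $$\Bigl|\langle L_\gamma(\sigma,\phi)\rangle_{\beta,\kappa,\infty}-\langle L_\gamma(\sigma,\phi)\rangle_{\infty,\kappa,\infty}\Bigr|\le 2K'\bigl(1+KK'\alpha_0(\kappa)\bigr)\,|\operatorname{supp}\gamma|\,\alpha_0(\kappa)\,\alpha_1(\beta)^6,$$ where $K=18^{-3}\bigl(1-18^2(2+\alpha_0(\kappa))\alpha_0(\kappa)\bigr)^{-1}$ and $K'=18^2\bigl(2+\alpha_0(\kappa)\bigr)$. -/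

import Mathlib

open Filter Topology

noncomputable section

namespace LatticeHiggs

/-! ## Cells of the lattice `ℤ⁴` and of the box `B_N = [-N, N]⁴ ∩ ℤ⁴` -/

/-- Points of `ℤ⁴`, that is, positively oriented 0-cells. -/
abbrev Site : Type := Fin 4 → ℤ

/-- Positively oriented edges: `(a, j)` is the edge from `a` to `a + e_j`. -/
abbrev PosEdge : Type := Site × Fin 4

/-- Pairs of directions `i < j`. -/
abbrev Plane : Type := {q : Fin 4 × Fin 4 // q.1 < q.2}

/-- Positively oriented plaquettes: `(a, (i, j))` with `i < j` is the unit square at `a` spanned by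
`e_i` and `e_j`. -/
abbrev PosPlaq : Type := Site × Plane

/-- The standard unit vector `e_j`. -/
def unit (j : Fin 4) : Site := Pi.single j 1

/-- The box `B_N`. -/
def box (N : ℕ) : Finset Site := Fintype.piFinset fun _ => Finset.Icc (-(N : ℤ)) (N : ℤ)

/-- The positively oriented edges in `B_N`: both endpoints lie in `B_N`. -/
def edges (N : ℕ) : Finset PosEdge :=
  (box N ×ˢ Finset.univ).filter fun e => e.1 + unit e.2 ∈ box N

/-- The positively oriented plaquettes in `B_N`: all four corners lie in `B_N`. -/
def plaqs (N : ℕ) : Finset PosPlaq :=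
  (box N ×ˢ Finset.univ).filter fun p =>
    p.1 + unit p.2.1.1 ∈ box N ∧ p.1 + unit p.2.1.2 ∈ box N ∧
      p.1 + unit p.2.1.1 + unit p.2.1.2 ∈ box N

/-! ## Chains and boundaries -/

/-- The boundary of a positively oriented edge, as a 0-chain. -/
def edgeBoundary (e : PosEdge) : Site →₀ ℤ :=
  Finsupp.single (e.1 + unit e.2) 1 - Finsupp.single e.1 1

/-- The boundary of a 1-chain. -/
def chainBoundary (γ : PosEdge →₀ ℤ) : Site →₀ ℤ :=
  γ.sum fun e c => c • edgeBoundary e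

/-- The boundary of a positively oriented plaquette, as a 1-chain. -/
def plaqBoundary (p : PosPlaq) : PosEdge →₀ ℤ :=
  Finsupp.single (p.1, p.2.1.1) 1 + Finsupp.single (p.1 + unit p.2.1.1, p.2.1.2) 1
    - Finsupp.single (p.1 + unit p.2.1.2, p.2.1.1) 1 - Finsupp.single (p.1, p.2.1.2) 1

/-- A generalized loop: a finitely supported 1-chain with coefficients in `{-1, 0, 1}` and empty
boundary. -/
def IsGeneralizedLoop (γ : PosEdge →₀ ℤ) : Prop :=
  (∀ e, γ e = -1 ∨ γ e = 0 ∨ γ e = 1) ∧ chainBoundary γ = 0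

/-- An open path from `x₁` to `x₂`: a finitely supported 1-chain with coefficients in `{-1, 0, 1}`
and boundary `x₂ - x₁`. -/
def IsOpenPath (γ : PosEdge →₀ ℤ) (x₁ x₂ : Site) : Prop :=
  (∀ e, γ e = -1 ∨ γ e = 0 ∨ γ e = 1) ∧
    chainBoundary γ = Finsupp.single x₂ 1 - Finsupp.single x₁ 1

/-- A path is a generalized loop or an open path. -/
def IsPath (γ : PosEdge →₀ ℤ) : Prop :=
  IsGeneralizedLoop γ ∨ ∃ x₁ x₂, IsOpenPath γ x₁ x₂

/-! ## Discrete differential forms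

A `k`-form on `B_N` is determined by its values on the positively oriented `k`-cells of `B_N`, so
`ZMod n`-valued `k`-forms are represented as functions on these cells. An oriented `k`-cell is a pair
`(c, s)` of a positively oriented cell `c` and a sign `s`, and `ω (c, s) = s • ω c`. -/

/-- The forms whose underlying positively oriented cells are the elements of `S`. -/
abbrev Form {ι : Type} (n : ℕ) (S : Finset ι) : Type := S → ZMod n

/-- The value of a form on a chain (for chains supported in `S`, this is the value at the chain of
the homomorphism extending the form; cells outside `S` are ignored). -/
def Form.onChain {ι : Type} {n : ℕ} {S : Finset ι} (ω : Form n S) (q : ι →₀ ℤ) : ZMod n :=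
  ∑ c : S, q c • ω c

/-- The exterior derivative of a 1-form on `B_N`: `dσ(p) = σ(∂p)`. -/
def dOne {n N : ℕ} (σ : Form n (edges N)) : Form n (plaqs N) :=
  fun p => σ.onChain (plaqBoundary p)

/-! ## The fixed length lattice Higgs model -/

section Model

variable {n : ℕ} (ρ : AddChar (ZMod n) Circle)

/-- The action of the fixed length lattice Higgs model on `B_N`. Both sums are over all oriented
cells. -/
def action (N : ℕ) (β κ : ℝ) (σ : Form n (edges N)) (φ : Form n (box N)) : ℂ :=
  - (β : ℂ) * ∑ p : plaqs N × ℤˣ, (ρ ((p.2 : ℤ) • dOne σ p.1) : ℂ)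
  - (κ : ℂ) * ∑ e : edges N × ℤˣ,
      (ρ ((e.2 : ℤ) • (σ e.1 - φ.onChain (edgeBoundary e.1))) : ℂ)

/-- The action is real, so nothing is lost by taking its real part below. -/
theorem action_im (N : ℕ) (β κ : ℝ) (σ : Form n (edges N)) (φ : Form n (box N)) :
    (action ρ N β κ σ φ).im = 0 := by
  have key : ∀ g : ZMod n, ∑ s : ℤˣ, ((ρ ((s : ℤ) • g) : ℂ)).im = 0 := by
    intro g
    have h : (Finset.univ : Finset ℤˣ) = {1, -1} := by decide
    rw [h, Finset.sum_pair (by decide)]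
    simp [AddChar.map_neg_eq_inv]
  simp only [action, Complex.sub_im, Complex.mul_im, Complex.neg_re, Complex.neg_im,
    Complex.ofReal_re, Complex.ofReal_im, Complex.im_sum, Fintype.sum_prod_type, key]
  simp

variable [NeZero n]

/-- The unnormalized Gibbs weight. For `β < ∞` it is `exp (-S)`; for `β = ∞` it is supported on
closed gauge fields, where only the interaction term remains. -/
def weight (N : ℕ) (β : WithTop ℝ) (κ : ℝ) (σ : Form n (edges N)) (φ : Form n (box N)) : ℝ :=
  match β with
  | ⊤ => if dOne σ = 0 then Real.exp (-(action ρ N 0 κ σ φ).re) else 0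
  | (b : ℝ) => Real.exp (-(action ρ N b κ σ φ).re)

/-- The expectation of a complex-valued function with respect to the Gibbs measure on `B_N`. -/
def expectation (N : ℕ) (β : WithTop ℝ) (κ : ℝ)
    (f : Form n (edges N) → Form n (box N) → ℂ) : ℂ :=
  (∑ σ : Form n (edges N), ∑ φ : Form n (box N), (weight ρ N β κ σ φ : ℂ) * f σ φ) /
    ((∑ σ : Form n (edges N), ∑ φ : Form n (box N), weight ρ N β κ σ φ : ℝ) : ℂ)

/-- The Wilson line observable `ρ(σ(γ) - φ(∂γ))`. -/
def wilsonLine (γ : PosEdge →₀ ℤ) (N : ℕ) (σ : Form n (edges N)) (φ : Form n (box N)) : ℂ :=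
  (ρ (σ.onChain γ - φ.onChain (chainBoundary γ)) : ℂ)

/-- `ℓ` is the infinite volume expectation of the Wilson line observable along `γ`. Once `B_N`
contains all edges of `γ`, the observable on `B_N` is the honest one, so the values for
small `N` are irrelevant. -/
def IsWilsonLineExpectation (β : WithTop ℝ) (κ : ℝ) (γ : PosEdge →₀ ℤ) (ℓ : ℂ) : Prop :=
  Tendsto (fun N : ℕ => expectation ρ N β κ (wilsonLine ρ γ N)) atTop (𝓝 ℓ)

/-! ## Constants -/

/-- `φ_r(g) = exp (r Re(ρ(g) - ρ(0)))`. -/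
def phi (r : ℝ) (g : ZMod n) : ℝ := Real.exp (r * ((ρ g : ℂ) - (ρ 0 : ℂ)).re)

/-- `α₀(r)`, the sum of `φ_r(g)²` over `g ≠ 0`. -/
def alpha0 (r : ℝ) : ℝ := ∑ g ∈ (Finset.univ : Finset (ZMod n)).erase 0, phi ρ r g ^ 2

/-- `α₁(r)`, the maximum of `φ_r(g)²` over `g ≠ 0`. -/
def alpha1 (r : ℝ) : ℝ := ⨆ g : {g : ZMod n // g ≠ 0}, phi ρ r g ^ 2

/-- `K = 18⁻³ (1 - 18² (2 + α₀(κ)) α₀(κ))⁻¹`. -/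
def constK (κ : ℝ) : ℝ :=
  ((18 : ℝ) ^ 3)⁻¹ * (1 - 18 ^ 2 * (2 + alpha0 ρ κ) * alpha0 ρ κ)⁻¹

/-- `K' = 18² (2 + α₀(κ))`. -/
def constK' (κ : ℝ) : ℝ := 18 ^ 2 * (2 + alpha0 ρ κ)

end Model

end LatticeHiggs

end

/-!
In unitary gauge the Higgs field disappears: the substitution `σ ↦ σ + dφ` makes both the weight and
the observable independent of `φ`, so that the expectation is a ratio of sums over 1-forms `σ` with
weight `∏ f(dσ(p)) ∏ g(σ(e))`, where `g = φ_κ²`, and `f = φ_β²` for finite `β` while `f` is the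
indicator function of `0` for `β = ∞` (`expectation_eq_gibbsExp`).

Two such weights `W₁`, `W₂` are compared by swapping clusters. For an independent pair `(σ, σ')`,
consider the connected components of the set of edges where `σ` or `σ'` is nonzero, two edges being
adjacent if they share a plaquette. Weights factorize over components. If `W₁` and `W₂` agree on the
restrictions of `σ` and `σ'` to every component meeting `supp γ`, exchanging `σ` and `σ'` on these
components preserves the product weight and exchanges the two values of the observable, so these
pairs contribute nothing to the difference of the expectations. Hence the difference is at most twice
the probability that some `e ∈ supp γ` lies in a component on which the weights disagree
(`norm_sum_pairWeight_mul_sub_le`). Erasing this component gives a Peierls bound: a given connected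
set `S` occurs with probability at most `y ^ |S|`, where `y = α₀(κ) (2 + α₀(κ)) < 1 / 324`
(`sum_bad_cluster_le`).

The connected sets `S` containing `e` are counted by percolation: the events that the open cluster of
`e` equals `S` are disjoint, which yields `∑ 96 ^ (-|S|) ≤ 1` and thus `∑ y ^ |S| ≤ 96 y`
(`sum_cluster_inv_pow_le_one`). As `96 y < 1`, components reaching the boundary of a large box have
negligible weight.

This is used twice. For the weights of two boxes, only components near the boundary of the smaller
box matter, so the expectations on boxes form a Cauchy sequence (`exists_tendsto_gibbsExp`). For the
weights with `β < ∞` and `β = ∞`, a component away from the boundary on which the weights disagree has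
`dσ ≠ 0`; a finitely supported nonzero exact 2-form on `ℤ⁴` is nonzero on at least six plaquettes
(`six_le_card_curlAt_ne_zero`), which gives the factor `α₁(β) ^ 6`
(`norm_gibbsExp_sub_closed_le`).
-/

noncomputable section

namespace LatticeHiggs

/-! ### Clusters in a finite graph -/

section Cluster

open Relation Classical

variable {V : Type*} (adj : V → V → Prop)

/-- `a` and `b` are adjacent vertices of `U`. -/
def Linked (U : Finset V) (a b : V) : Prop := a ∈ U ∧ b ∈ U ∧ adj a b

/-- The set of vertices of `U` that can be reached from `A` by a path in `U`. Elements of `A` that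
do not lie in `U` are ignored. -/
def cluster (A U : Finset V) : Finset V :=
  U.filter fun b => ∃ a ∈ A, ReflTransGen (Linked adj U) a b

/-- `S` is a union of connected components of `U`. -/
def IsComponentUnion (S U : Finset V) : Prop :=
  S ⊆ U ∧ ∀ a ∈ S, ∀ b ∈ U, adj a b → b ∈ S

variable {adj} {A S U : Finset V}

lemma cluster_subset : cluster adj A U ⊆ U := Finset.filter_subset _ _

lemma mem_cluster_of_mem {a : V} (ha : a ∈ A) (hU : a ∈ U) : a ∈ cluster adj A U :=
  Finset.mem_filter.2 ⟨hU, a, ha, .refl⟩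

lemma isComponentUnion_cluster : IsComponentUnion adj (cluster adj A U) U := by
  refine ⟨cluster_subset, fun a ha b hb hab => ?_⟩
  obtain ⟨haU, c, hc, hca⟩ := Finset.mem_filter.1 ha
  exact Finset.mem_filter.2 ⟨hb, c, hc, hca.tail ⟨haU, hb, hab⟩⟩

lemma IsComponentUnion.reach (h : IsComponentUnion adj S U) {a b : V} (ha : a ∈ S)
    (hab : ReflTransGen (Linked adj U) a b) : b ∈ S ∧ ReflTransGen (Linked adj S) a b := by
  induction hab with
  | refl => exact ⟨ha, .refl⟩
  | tail _ hbc ih =>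
    have hc := h.2 _ ih.1 _ hbc.2.1 hbc.2.2
    exact ⟨hc, ih.2.tail ⟨ih.1, hc, hbc.2.2⟩⟩

lemma mem_of_reach {a b : V} (hab : ReflTransGen (Linked adj U) a b) (hb : b ∈ U) : a ∈ U := by
  rcases ReflTransGen.cases_head hab with h | ⟨c, hc, _⟩
  · exact h ▸ hb
  · exact hc.1

lemma cluster_subset_of_isComponentUnion (h : IsComponentUnion adj S U)
    (hA : ∀ a ∈ A, a ∈ U → a ∈ S) : cluster adj A U ⊆ S := by
  intro b hb
  obtain ⟨hbU, a, ha, hab⟩ := Finset.mem_filter.1 hb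
  exact (h.reach (hA a ha (mem_of_reach hab hbU)) hab).1

lemma cluster_eq_of_isComponentUnion (h : IsComponentUnion adj S U)
    (hA : ∀ a ∈ A, a ∈ U → a ∈ S) : cluster adj A U = cluster adj A S := by
  ext b
  constructor
  · intro hb
    obtain ⟨hbU, a, ha, hab⟩ := Finset.mem_filter.1 hb
    have := h.reach (hA a ha (mem_of_reach hab hbU)) hab
    exact Finset.mem_filter.2 ⟨this.1, a, ha, this.2⟩
  · intro hb
    obtain ⟨hbS, a, ha, hab⟩ := Finset.mem_filter.1 hb
    exact Finset.mem_filter.2 ⟨h.1 hbS, a, ha,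
      ReflTransGen.mono (fun _ _ hxy => ⟨h.1 hxy.1, h.1 hxy.2.1, hxy.2.2⟩) _ _ hab⟩

lemma cluster_cluster : cluster adj A (cluster adj A U) = cluster adj A U :=
  (cluster_eq_of_isComponentUnion isComponentUnion_cluster
    fun _ ha hU => mem_cluster_of_mem ha hU).symm

lemma mem_of_cluster_singleton_eq {e : V} (h : cluster adj {e} S = S) (hS : S.Nonempty) :
    e ∈ S := by
  obtain ⟨b, hb⟩ := hS
  rw [← h] at hb
  obtain ⟨hbS, a, ha, hab⟩ := Finset.mem_filter.1 hb
  rw [Finset.mem_singleton.1 ha] at hab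
  exact mem_of_reach hab hbS

/-- A connected set of `m` vertices cannot reach further than distance `m`: here distance is
measured by any function that is 1-Lipschitz along edges. -/
lemma lt_add_card_of_mem_cluster {e b : V} (D : V → ℕ) (hD : ∀ a b, adj a b → D b ≤ D a + 1)
    (hb : b ∈ cluster adj {e} S) : D b < D e + S.card := by
  obtain ⟨hbS, a, ha, hab⟩ := Finset.mem_filter.1 hb
  rw [Finset.mem_singleton.1 ha] at hab
  have heS := mem_of_reach hab hbS
  have key : ∀ t, D e ≤ t → t ≤ D b → ∃ c ∈ S, D c = t := by
    clear hb hbS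
    induction hab with
    | refl => exact fun t h1 h2 => ⟨e, heS, le_antisymm h1 h2⟩
    | tail _ hbc ih =>
      intro t h1 h2
      rcases Nat.lt_or_ge t (D _ + 1) with h | h
      · exact ih t h1 (Nat.lt_succ_iff.1 h)
      · exact ⟨_, hbc.2.1, le_antisymm ((hD _ _ hbc.2.2).trans h) h2⟩
  have hsub : Finset.Icc (D e) (D b) ⊆ S.image D := by
    intro t ht
    rw [Finset.mem_Icc] at ht
    exact Finset.mem_image.2 (key t ht.1 ht.2)
  have h1 := (Finset.card_le_card hsub).trans Finset.card_image_le
  have h2 : 0 < S.card := Finset.card_pos.2 ⟨e, heS⟩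
  rw [Nat.card_Icc] at h1
  omega

variable [DecidableEq V]

lemma IsComponentUnion.sdiff (hadj : ∀ a b, adj a b → adj b a) (h : IsComponentUnion adj S U) :
    IsComponentUnion adj (U \ S) U := by
  refine ⟨Finset.sdiff_subset, fun a ha b hb hab => ?_⟩
  rw [Finset.mem_sdiff] at ha ⊢
  exact ⟨hb, fun hbS => ha.2 (h.2 b hbS a ha.1 (hadj _ _ hab))⟩

lemma cluster_insert (e : V) :
    cluster adj (insert e A) U = cluster adj {e} U ∪ cluster adj A U := by
  ext b
  simp only [cluster, Finset.mem_filter, Finset.mem_union, Finset.mem_insert,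
    Finset.mem_singleton, exists_eq_or_imp, exists_eq_left]
  tauto

lemma cluster_singleton_subset_or_disjoint (hadj : ∀ a b, adj a b → adj b a) (e : V) :
    cluster adj {e} U ⊆ cluster adj A U ∨ Disjoint (cluster adj {e} U) (cluster adj A U) := by
  by_cases he : e ∈ cluster adj A U
  · left
    refine cluster_subset_of_isComponentUnion isComponentUnion_cluster ?_
    simpa using fun _ => he
  · right
    have : cluster adj {e} U ⊆ U \ cluster adj A U := by
      refine cluster_subset_of_isComponentUnion (isComponentUnion_cluster.sdiff hadj) ?_
      simpa using fun h => ⟨h, he⟩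
    exact Finset.disjoint_of_subset_left this Finset.sdiff_disjoint

end Cluster

/-! ### Counting connected sets by percolation -/

section Percolation

open Classical

variable {V : Type*} [Fintype V] [DecidableEq V] {adj : V → V → Prop}

/-- In Bernoulli percolation with parameter `p`, the cluster of `e` equals a given connected set `S`
as soon as `S` is open and its outer boundary, which has at most `Δ |S|` vertices, is closed.
These events are disjoint for different `S`. -/
lemma sum_cluster_pow_le_one {Δ : ℕ} (nbr : V → Finset V) (hnbr : ∀ a b, adj a b → b ∈ nbr a)
    (hΔ : ∀ a, (nbr a).card ≤ Δ) (p : ℝ) (hp0 : 0 ≤ p) (hp1 : p ≤ 1) (e : V) :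
    ∑ S ∈ (Finset.univ : Finset (Finset V)).filter
        (fun S => cluster adj {e} S = S ∧ S.Nonempty), (p * (1 - p) ^ Δ) ^ S.card ≤ 1 := by
  set 𝒮 := (Finset.univ : Finset (Finset V)).filter
    (fun S => cluster adj {e} S = S ∧ S.Nonempty) with h𝒮
  have hq0 : 0 ≤ 1 - p := by linarith
  set μ : Finset V → ℝ := fun U => p ^ U.card * (1 - p) ^ (Fintype.card V - U.card) with hμ
  have hμ0 : ∀ U, 0 ≤ μ U := fun U => by positivity
  have htotal : ∑ U, μ U = 1 := by
    have := Finset.sum_pow_mul_eq_add_pow p (1 - p) (Finset.univ : Finset V)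
    simpa [hμ] using this
  have hS : ∀ S ∈ 𝒮, (p * (1 - p) ^ Δ) ^ S.card ≤
      ∑ U ∈ (Finset.univ : Finset (Finset V)).filter (fun U => cluster adj {e} U = S), μ U := by
    intro S hS
    obtain ⟨-, hcl, hne⟩ := Finset.mem_filter.1 hS
    set B := S.biUnion nbr \ S with hB
    have hBcard : B.card ≤ S.card * Δ :=
      (Finset.card_le_card Finset.sdiff_subset).trans
        (Finset.card_biUnion_le_card_mul _ _ _ fun a _ => hΔ a)
    set R := (Finset.univ : Finset V) \ (S ∪ B) with hR
    have hSB : Disjoint S B := Finset.disjoint_sdiff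
    have hcard : R.card + (S.card + B.card) = Fintype.card V := by
      rw [← Finset.card_union_of_disjoint hSB, hR, Finset.card_sdiff_add_card_eq_card
        (Finset.subset_univ _), Finset.card_univ]
    have hdisj : ∀ T ∈ R.powerset, Disjoint S T := by
      intro T hT
      rw [Finset.mem_powerset] at hT
      rw [Finset.disjoint_left]
      intro a ha haT
      have := hT haT
      simp [hR, ha] at this
    have hinj : Set.InjOn (fun T => S ∪ T) (R.powerset : Set (Finset V)) := by
      intro T hT T' hT' h
      have h1 := hdisj T (Finset.mem_coe.1 hT)
      have h2 := hdisj T' (Finset.mem_coe.1 hT')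
      calc T = (S ∪ T) \ S := (Finset.union_sdiff_cancel_left h1).symm
        _ = (S ∪ T') \ S := by rw [show S ∪ T = S ∪ T' from h]
        _ = T' := Finset.union_sdiff_cancel_left h2
    -- Opening `S`, closing its outer boundary `B` and choosing the state of all other vertices
    -- freely, the cluster of `e` is `S`.
    have hsub : R.powerset.image (fun T => S ∪ T) ⊆
        (Finset.univ : Finset (Finset V)).filter (fun U => cluster adj {e} U = S) := by
      intro U hU
      obtain ⟨T, hT, rfl⟩ := Finset.mem_image.1 hU
      refine Finset.mem_filter.2 ⟨Finset.mem_univ _, ?_⟩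
      rw [Finset.mem_powerset] at hT
      have hcomp : IsComponentUnion adj S (S ∪ T) := by
        refine ⟨Finset.subset_union_left, fun a ha b hb hab => ?_⟩
        by_contra hbS
        have hbT : b ∈ T := (Finset.mem_union.1 hb).resolve_left hbS
        have hbB : b ∈ B :=
          Finset.mem_sdiff.2 ⟨Finset.mem_biUnion.2 ⟨a, ha, hnbr a b hab⟩, hbS⟩
        have := hT hbT
        simp [hR, hbB] at this
      rw [cluster_eq_of_isComponentUnion hcomp, hcl]
      simpa using fun _ => mem_of_cluster_singleton_eq hcl hne
    calc (p * (1 - p) ^ Δ) ^ S.card = p ^ S.card * (1 - p) ^ (S.card * Δ) := by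
          rw [mul_pow, ← pow_mul, mul_comm Δ]
      _ ≤ p ^ S.card * (1 - p) ^ B.card :=
          mul_le_mul_of_nonneg_left (pow_le_pow_of_le_one hq0 (by linarith) hBcard) (by positivity)
      _ = p ^ S.card * (1 - p) ^ B.card *
            ∑ T ∈ R.powerset, p ^ T.card * (1 - p) ^ (R.card - T.card) := by
          rw [Finset.sum_pow_mul_eq_add_pow]; simp
      _ = ∑ T ∈ R.powerset, μ (S ∪ T) := by
          rw [Finset.mul_sum]
          refine Finset.sum_congr rfl fun T hT => ?_
          have h1 : (S ∪ T).card = S.card + T.card :=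
            Finset.card_union_of_disjoint (hdisj T hT)
          have h2 : T.card ≤ R.card := Finset.card_le_card (Finset.mem_powerset.1 hT)
          have h3 : Fintype.card V - (S ∪ T).card = B.card + (R.card - T.card) := by omega
          simp only [hμ]
          rw [h3, h1, pow_add, pow_add]
          ring
      _ = ∑ U ∈ R.powerset.image (fun T => S ∪ T), μ U :=
          (Finset.sum_image hinj).symm
      _ ≤ _ := Finset.sum_le_sum_of_subset_of_nonneg hsub fun U _ _ => hμ0 U
  calc _ ≤ ∑ S ∈ 𝒮, ∑ U ∈ (Finset.univ : Finset (Finset V)).filter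
          (fun U => cluster adj {e} U = S), μ U := Finset.sum_le_sum hS
    _ ≤ ∑ S, ∑ U ∈ (Finset.univ : Finset (Finset V)).filter
          (fun U => cluster adj {e} U = S), μ U :=
        Finset.sum_le_sum_of_subset_of_nonneg (Finset.subset_univ _)
          fun S _ _ => Finset.sum_nonneg fun U _ => hμ0 U
    _ = ∑ U, μ U := Finset.sum_fiberwise _ _ _
    _ = 1 := htotal

/-- The percolation bound for a graph of maximal degree at most 24, at the parameter `1 / 48`, for
which `(1 - 1 / 48) ^ 24 ≥ 1 / 2`. -/
lemma sum_cluster_inv_pow_le_one (nbr : V → Finset V) (hnbr : ∀ a b, adj a b → b ∈ nbr a)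
    (hΔ : ∀ a, (nbr a).card ≤ 24) (e : V) :
    ∑ S ∈ (Finset.univ : Finset (Finset V)).filter
        (fun S => cluster adj {e} S = S ∧ S.Nonempty), (1 / 96 : ℝ) ^ S.card ≤ 1 := by
  refine le_trans (Finset.sum_le_sum fun S _ => ?_)
    (sum_cluster_pow_le_one nbr hnbr hΔ (1 / 48) (by norm_num) (by norm_num) e)
  exact pow_le_pow_left₀ (by norm_num) (by norm_num) _

end Percolation

/-! ### Configurations and local weights -/

section LocalWeight

open Classical

variable {V H G : Type*}

/-- The restriction of a configuration to `S`, extended by zero. -/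
def restrict [Zero H] (S : Finset V) (τ : V → H) : V → H := fun v => if v ∈ S then τ v else 0

/-- The set of vertices at which a configuration is nonzero. -/
def supp [Fintype V] [Zero H] (τ : V → H) : Finset V := Finset.univ.filter fun v => τ v ≠ 0

lemma mem_supp [Fintype V] [Zero H] {τ : V → H} {v : V} : v ∈ supp τ ↔ τ v ≠ 0 := by
  simp [supp]

lemma restrict_apply_of_mem [Zero H] {S : Finset V} {τ : V → H} {v : V} (h : v ∈ S) :
    restrict S τ v = τ v := if_pos h

lemma restrict_apply_of_notMem [Zero H] {S : Finset V} {τ : V → H} {v : V} (h : v ∉ S) :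
    restrict S τ v = 0 := if_neg h

lemma restrict_empty [Zero H] (τ : V → H) : restrict ∅ τ = 0 := by
  funext v; simp [restrict]

lemma supp_restrict [Fintype V] [Zero H] {S : Finset V} {τ : V → H} (h : S ⊆ supp τ) :
    supp (restrict S τ) = S := by
  ext v
  by_cases hv : v ∈ S
  · simp [mem_supp, restrict_apply_of_mem hv, hv, mem_supp.1 (h hv)]
  · simp [mem_supp, restrict_apply_of_notMem hv, hv]

lemma fst_restrict [Zero G] (S : Finset V) (ω : V → G × G) :
    (fun v => (restrict S ω v).1) = restrict S fun v => (ω v).1 := by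
  funext v
  by_cases hv : v ∈ S <;> simp [restrict, hv]

lemma snd_restrict [Zero G] (S : Finset V) (ω : V → G × G) :
    (fun v => (restrict S ω v).2) = restrict S fun v => (ω v).2 := by
  funext v
  by_cases hv : v ∈ S <;> simp [restrict, hv]

lemma ne_zero_of_fst [Zero G] {x : G × G} (h : x.1 ≠ 0) : x ≠ 0 := fun h0 => h (by rw [h0]; rfl)

lemma ne_zero_of_snd [Zero G] {x : G × G} (h : x.2 ≠ 0) : x ≠ 0 := fun h0 => h (by rw [h0]; rfl)

/-- Exchange the two configurations of a pair on `C`. -/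
def swapOn (C : Finset V) (ω : V → G × G) : V → G × G :=
  fun v => if v ∈ C then (ω v).swap else ω v

lemma swapOn_swapOn (C : Finset V) (ω : V → G × G) : swapOn C (swapOn C ω) = ω := by
  funext v
  by_cases hv : v ∈ C <;> simp [swapOn, hv]

lemma fst_restrict_swapOn [Zero G] (C : Finset V) (ω : V → G × G) :
    (restrict C fun v => (swapOn C ω v).1) = restrict C fun v => (ω v).2 := by
  funext v
  by_cases hv : v ∈ C <;> simp [restrict, swapOn, hv]

lemma snd_restrict_swapOn [Zero G] (C : Finset V) (ω : V → G × G) :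
    (restrict C fun v => (swapOn C ω v).2) = restrict C fun v => (ω v).1 := by
  funext v
  by_cases hv : v ∈ C <;> simp [restrict, swapOn, hv]

/-- The two weights agree on both configurations of the pair `ω`. -/
def Agree (W₁ W₂ : (V → G) → ℝ) (ω : V → G × G) : Prop :=
  W₁ (fun v => (ω v).1) = W₂ (fun v => (ω v).1) ∧ W₁ (fun v => (ω v).2) = W₂ (fun v => (ω v).2)

lemma agree_restrict_swapOn [Zero G] {W₁ W₂ : (V → G) → ℝ} {C : Finset V} {ω : V → G × G} :
    Agree W₁ W₂ (restrict C (swapOn C ω)) ↔ Agree W₁ W₂ (restrict C ω) := by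
  simp only [Agree, fst_restrict, snd_restrict, fst_restrict_swapOn, snd_restrict_swapOn]
  exact and_comm

/-- A nonnegative weight on configurations which is normalized at the zero configuration and
factorizes over parts of a configuration that are not adjacent to each other. -/
structure IsLocalWeight [Fintype V] [DecidableEq V] [Zero H] (adj : V → V → Prop)
    (W : (V → H) → ℝ) : Prop where
  nonneg : ∀ τ, 0 ≤ W τ
  map_zero : W 0 = 1
  map_mul : ∀ τ S, (∀ a ∈ S, ∀ b ∉ S, τ a ≠ 0 → τ b ≠ 0 → ¬ adj a b) →
    W τ = W (restrict S τ) * W (restrict Sᶜ τ)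

variable [Fintype V] [DecidableEq V] [Zero H] [Zero G] {adj : V → V → Prop}

namespace IsLocalWeight

lemma map_mul_of_isComponentUnion {W : (V → H) → ℝ} (hW : IsLocalWeight adj W) {τ : V → H}
    {S U : Finset V} (hS : IsComponentUnion adj S U) (hU : ∀ v, τ v ≠ 0 → v ∈ U) :
    W τ = W (restrict S τ) * W (restrict Sᶜ τ) :=
  hW.map_mul τ S fun a ha b hb _ hτb hab => hb (hS.2 a ha b (hU b hτb) hab)

lemma map_restrict_union {W : (V → H) → ℝ} (hW : IsLocalWeight adj W) {τ : V → H}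
    {S T U : Finset V} (hS : IsComponentUnion adj S U) (hU : ∀ v, τ v ≠ 0 → v ∈ U)
    (hST : Disjoint S T) :
    W (restrict (S ∪ T) τ) = W (restrict S τ) * W (restrict T τ) := by
  have h1 : restrict S (restrict (S ∪ T) τ) = restrict S τ := by
    funext v
    by_cases hv : v ∈ S <;> simp [restrict, hv]
  have h2 : restrict Sᶜ (restrict (S ∪ T) τ) = restrict T τ := by
    funext v
    by_cases hv : v ∈ S
    · simp [restrict, hv, Finset.disjoint_left.1 hST hv]
    · simp [restrict, hv]
  rw [hW.map_mul_of_isComponentUnion (τ := restrict (S ∪ T) τ) hS, h1, h2]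
  intro v hv
  refine hU v fun h0 => hv ?_
  simp [restrict, h0]

/-- Two local weights that agree on each of finitely many clusters agree on their union. -/
lemma eq_on_cluster {W₁ W₂ : (V → H) → ℝ} (hW₁ : IsLocalWeight adj W₁)
    (hW₂ : IsLocalWeight adj W₂) (hadj : ∀ a b, adj a b → adj b a) {τ : V → H}
    {A U : Finset V} (hU : ∀ v, τ v ≠ 0 → v ∈ U)
    (h : ∀ e ∈ A, W₁ (restrict (cluster adj {e} U) τ) = W₂ (restrict (cluster adj {e} U) τ)) :
    W₁ (restrict (cluster adj A U) τ) = W₂ (restrict (cluster adj A U) τ) := by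
  induction A using Finset.induction_on with
  | empty =>
    have : cluster adj ∅ U = ∅ := by simp [cluster]
    rw [this, restrict_empty, hW₁.map_zero, hW₂.map_zero]
  | insert e A _ ih =>
    have ihA := ih fun e he => h e (Finset.mem_insert_of_mem he)
    rw [cluster_insert]
    rcases cluster_singleton_subset_or_disjoint (A := A) (U := U) hadj e with hs | hd
    · rwa [Finset.union_eq_right.2 hs]
    · rw [hW₁.map_restrict_union isComponentUnion_cluster hU hd,
        hW₂.map_restrict_union isComponentUnion_cluster hU hd, ihA,
        h e (Finset.mem_insert_self _ _)]

end IsLocalWeight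

/-- The product of two weights, on pairs of configurations. -/
def pairWeight (W₁ W₂ : (V → G) → ℝ) (ω : V → G × G) : ℝ :=
  W₁ (fun v => (ω v).1) * W₂ (fun v => (ω v).2)

lemma IsLocalWeight.pairWeight {W₁ W₂ : (V → G) → ℝ} (hW₁ : IsLocalWeight adj W₁)
    (hW₂ : IsLocalWeight adj W₂) : IsLocalWeight adj (pairWeight W₁ W₂) where
  nonneg ω := mul_nonneg (hW₁.nonneg _) (hW₂.nonneg _)
  map_zero := by
    have h1 := hW₁.map_zero
    have h2 := hW₂.map_zero
    simp only [LatticeHiggs.pairWeight]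
    change W₁ 0 * W₂ 0 = 1
    rw [h1, h2, one_mul]
  map_mul ω S h := by
    simp only [LatticeHiggs.pairWeight, fst_restrict, snd_restrict]
    rw [hW₁.map_mul _ S fun a ha b hb ha0 hb0 =>
        h a ha b hb (ne_zero_of_fst ha0) (ne_zero_of_fst hb0),
      hW₂.map_mul _ S fun a ha b hb ha0 hb0 =>
        h a ha b hb (ne_zero_of_snd ha0) (ne_zero_of_snd hb0)]
    ring

/-! ### Swapping clusters -/

lemma supp_swapOn (C : Finset V) (ω : V → G × G) : supp (swapOn C ω) = supp ω := by
  ext v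
  by_cases hv : v ∈ C
  · simp [mem_supp, swapOn, hv, Prod.ext_iff, and_comm]
  · simp [mem_supp, swapOn, hv]

lemma fst_restrict_compl_swapOn (C : Finset V) (ω : V → G × G) :
    (restrict Cᶜ fun v => (swapOn C ω v).1) = restrict Cᶜ fun v => (ω v).1 := by
  funext v
  by_cases hv : v ∈ C <;> simp [restrict, swapOn, hv]

lemma snd_restrict_compl_swapOn (C : Finset V) (ω : V → G × G) :
    (restrict Cᶜ fun v => (swapOn C ω v).2) = restrict Cᶜ fun v => (ω v).2 := by
  funext v
  by_cases hv : v ∈ C <;> simp [restrict, swapOn, hv]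

/-- Swapping a union of clusters on which the two weights agree preserves the product weight. -/
lemma pairWeight_swapOn {W₁ W₂ : (V → G) → ℝ} (hW₁ : IsLocalWeight adj W₁)
    (hW₂ : IsLocalWeight adj W₂) {C : Finset V} {ω : V → G × G}
    (hC : IsComponentUnion adj C (supp ω)) (h : Agree W₁ W₂ (restrict C ω)) :
    pairWeight W₁ W₂ (swapOn C ω) = pairWeight W₁ W₂ ω := by
  have hC' : IsComponentUnion adj C (supp (swapOn C ω)) := by rwa [supp_swapOn]
  have hP := hW₁.pairWeight hW₂
  have hs : ∀ ω : V → G × G, ∀ v, ω v ≠ 0 → v ∈ supp ω := fun ω v hv => mem_supp.2 hv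
  obtain ⟨h1, h2⟩ := h
  rw [hP.map_mul_of_isComponentUnion hC (hs _), hP.map_mul_of_isComponentUnion hC' (hs _)]
  simp only [pairWeight, fst_restrict, snd_restrict, fst_restrict_swapOn, snd_restrict_swapOn,
    fst_restrict_compl_swapOn, snd_restrict_compl_swapOn] at h1 h2 ⊢
  rw [h1, h2]
  ring

variable [Fintype G] [Fintype H]

/-- If the two weights agree on all clusters meeting `Γ`, swapping these clusters exchanges the
values of an observable that only depends on `Γ`. Hence only pairs for which the weights disagree
on the cluster of some `e ∈ Γ` contribute to the difference of the two expectations. -/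
lemma norm_sum_pairWeight_mul_sub_le {W₁ W₂ : (V → G) → ℝ} (hW₁ : IsLocalWeight adj W₁)
    (hW₂ : IsLocalWeight adj W₂) (hadj : ∀ a b, adj a b → adj b a) (Γ : Finset V)
    (h : (V → G) → ℂ) (hΓ : ∀ τ τ', (∀ v ∈ Γ, τ v = τ' v) → h τ = h τ') (hh : ∀ τ, ‖h τ‖ ≤ 1) :
    ‖∑ ω : V → G × G, (pairWeight W₁ W₂ ω : ℂ) * (h (fun v => (ω v).1) - h fun v => (ω v).2)‖ ≤
      ∑ e ∈ Γ, 2 * ∑ ω ∈ (Finset.univ : Finset (V → G × G)).filter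
        (fun ω => ¬ Agree W₁ W₂ (restrict (cluster adj {e} (supp ω)) ω)), pairWeight W₁ W₂ ω := by
  set good : (V → G × G) → Prop := fun ω => Agree W₁ W₂ (restrict (cluster adj Γ (supp ω)) ω)
  set F : (V → G × G) → ℂ := fun ω =>
    (pairWeight W₁ W₂ ω : ℂ) * (h (fun v => (ω v).1) - h fun v => (ω v).2) with hF
  have hP := hW₁.pairWeight hW₂
  set s : (V → G × G) → (V → G × G) := fun ω => swapOn (cluster adj Γ (supp ω)) ω with hs
  have hsupp : ∀ ω, supp (s ω) = supp ω := fun ω => supp_swapOn _ _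
  have hobs : ∀ ω, h (fun v => (s ω v).1) = h (fun v => (ω v).2) ∧
      h (fun v => (s ω v).2) = h (fun v => (ω v).1) := by
    intro ω
    constructor <;>
    · refine hΓ _ _ fun v hv => ?_
      by_cases hvC : v ∈ cluster adj Γ (supp ω)
      · simp [hs, swapOn, hvC]
      · have : ω v = 0 := by
          by_contra h0
          exact hvC (mem_cluster_of_mem hv (mem_supp.2 h0))
        simp [hs, swapOn, hvC, this]
  -- On good pairs the swap is an involution that preserves the weight and reverses the sign.
  have hgood : ∑ ω ∈ Finset.univ.filter good, F ω = 0 := by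
    have hneg : ∀ ω, good ω → F ω + F (s ω) = 0 := by
      intro ω hω
      simp only [hF]
      rw [(hobs ω).1, (hobs ω).2, pairWeight_swapOn hW₁ hW₂ isComponentUnion_cluster hω]
      ring
    refine Finset.sum_involution (fun ω _ => s ω) ?_ ?_ ?_ ?_
    · exact fun ω hω => hneg ω (Finset.mem_filter.1 hω).2
    · intro ω hω hne heq
      have := hneg ω (Finset.mem_filter.1 hω).2
      rw [heq] at this
      exact hne (self_eq_neg.1 (eq_neg_of_add_eq_zero_left this))
    · intro ω hω
      refine Finset.mem_filter.2 ⟨Finset.mem_univ _, ?_⟩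
      change Agree W₁ W₂ (restrict (cluster adj Γ (supp (s ω))) (s ω))
      rw [hsupp]
      exact agree_restrict_swapOn.2 (Finset.mem_filter.1 hω).2
    · intro ω _
      change swapOn (cluster adj Γ (supp (s ω))) (s ω) = ω
      rw [hsupp]
      exact swapOn_swapOn _ _
  rw [← Finset.sum_filter_add_sum_filter_not Finset.univ good, hgood, zero_add]
  have hbound : ∀ ω, ‖F ω‖ ≤ 2 * pairWeight W₁ W₂ ω := by
    intro ω
    simp only [hF]
    rw [norm_mul, Complex.norm_real, Real.norm_of_nonneg (hP.nonneg ω), mul_comm]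
    refine mul_le_mul_of_nonneg_right ?_ (hP.nonneg ω)
    calc _ ≤ ‖h fun v => (ω v).1‖ + ‖h fun v => (ω v).2‖ := norm_sub_le _ _
      _ ≤ 1 + 1 := add_le_add (hh _) (hh _)
      _ = 2 := by norm_num
  have hex : ∀ ω, ¬ good ω → ∃ e ∈ Γ, ¬ Agree W₁ W₂ (restrict (cluster adj {e} (supp ω)) ω) := by
    intro ω hω
    by_contra! hall
    simp only [good, Agree, fst_restrict, snd_restrict] at hω hall
    exact hω ⟨hW₁.eq_on_cluster hW₂ hadj (fun v hv => mem_supp.2 (ne_zero_of_fst hv))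
        fun e he => (hall e he).1,
      hW₁.eq_on_cluster hW₂ hadj (fun v hv => mem_supp.2 (ne_zero_of_snd hv))
        fun e he => (hall e he).2⟩
  calc _ ≤ ∑ ω ∈ Finset.univ.filter (fun ω => ¬ good ω), 2 * pairWeight W₁ W₂ ω :=
        norm_sum_le_of_le _ fun ω _ => hbound ω
    _ ≤ ∑ ω, ∑ e ∈ Γ, if ¬ Agree W₁ W₂ (restrict (cluster adj {e} (supp ω)) ω) then
          2 * pairWeight W₁ W₂ ω else 0 := by
        have hnn : ∀ (ω : V → G × G) (p : Prop) [Decidable p],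
            0 ≤ if p then 2 * pairWeight W₁ W₂ ω else 0 := fun ω p _ => by
          have := hP.nonneg ω
          split_ifs <;> positivity
        rw [Finset.sum_filter]
        refine Finset.sum_le_sum fun ω _ => ?_
        by_cases hω : good ω
        · rw [if_neg (not_not.2 hω)]
          exact Finset.sum_nonneg fun e _ => hnn ω _
        · obtain ⟨e, he, hbad⟩ := hex ω hω
          rw [if_pos hω]
          refine le_trans (le_of_eq ?_) (Finset.single_le_sum (fun e _ => hnn ω _) he)
          rw [if_pos hbad]
    _ = _ := by
        rw [Finset.sum_comm]
        refine Finset.sum_congr rfl fun e _ => ?_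
        rw [Finset.mul_sum, Finset.sum_filter]

/-- Peierls estimate: the total weight of the configurations whose cluster at `e` is bad is at most
the weight of the bad connected configurations at `e` times the partition function. -/
lemma sum_bad_cluster_le {W : (V → H) → ℝ} (hW : IsLocalWeight adj W) (e : V)
    (bad : (V → H) → Prop) :
    ∑ ω ∈ (Finset.univ : Finset (V → H)).filter
        (fun ω => bad (restrict (cluster adj {e} (supp ω)) ω)), W ω ≤
      (∑ ω ∈ (Finset.univ : Finset (V → H)).filter
        (fun ω => cluster adj {e} (supp ω) = supp ω ∧ bad ω), W ω) * ∑ ω, W ω := by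
  set C : (V → H) → Finset V := fun ω => cluster adj {e} (supp ω) with hC
  set split : (V → H) → (V → H) × (V → H) := fun ω => (restrict (C ω) ω, restrict (C ω)ᶜ ω)
  have hsupp : ∀ ω, supp (restrict (C ω) ω) = C ω := fun ω => supp_restrict cluster_subset
  -- The first part determines the cluster, hence the pair of parts determines the configuration.
  have hinj : Function.Injective split := by
    intro ω ω' h
    obtain ⟨h1, h2⟩ := Prod.mk.inj h
    have hCC : C ω = C ω' := by rw [← hsupp ω, ← hsupp ω', h1]
    rw [← hCC] at h1 h2
    funext v
    by_cases hv : v ∈ C ω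
    · have := congrFun h1 v
      rwa [restrict_apply_of_mem hv, restrict_apply_of_mem hv] at this
    · have := congrFun h2 v
      rwa [restrict_apply_of_mem (Finset.mem_compl.2 hv),
        restrict_apply_of_mem (Finset.mem_compl.2 hv)] at this
  rw [Finset.sum_mul_sum, ← Finset.sum_product']
  calc _ = ∑ ω ∈ (Finset.univ : Finset (V → H)).filter
          (fun ω => bad (restrict (cluster adj {e} (supp ω)) ω)),
            W (split ω).1 * W (split ω).2 :=
        Finset.sum_congr rfl fun ω _ => hW.map_mul_of_isComponentUnion
          isComponentUnion_cluster fun v hv => mem_supp.2 hv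
    _ = ∑ q ∈ ((Finset.univ : Finset (V → H)).filter
          (fun ω => bad (restrict (cluster adj {e} (supp ω)) ω))).image split, W q.1 * W q.2 :=
        (Finset.sum_image (f := fun q : (V → H) × (V → H) => W q.1 * W q.2) hinj.injOn).symm
    _ ≤ _ := by
        refine Finset.sum_le_sum_of_subset_of_nonneg ?_
          fun q _ _ => mul_nonneg (hW.nonneg _) (hW.nonneg _)
        intro q hq
        obtain ⟨ω, hω, rfl⟩ := Finset.mem_image.1 hq
        refine Finset.mem_product.2 ⟨Finset.mem_filter.2 ⟨Finset.mem_univ _, ?_, ?_⟩,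
          Finset.mem_univ _⟩
        · change cluster adj {e} (supp (restrict (C ω) ω)) = supp (restrict (C ω) ω)
          rw [hsupp]
          exact cluster_cluster
        · exact (Finset.mem_filter.1 hω).2

lemma sum_prod_of_supp_eq [DecidableEq H] (u : H → ℝ) (S : Finset V) :
    ∑ ω ∈ (Finset.univ : Finset (V → H)).filter (fun ω => supp ω = S), ∏ v ∈ supp ω, u (ω v) =
      (∑ x ∈ (Finset.univ : Finset H).erase 0, u x) ^ S.card := by
  set t : V → Finset H := fun v => if v ∈ S then (Finset.univ : Finset H).erase 0 else {0} with ht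
  set f : V → H → ℝ := fun v x => if v ∈ S then u x else 1 with hf
  have h1 : (Finset.univ : Finset (V → H)).filter (fun ω => supp ω = S) = Fintype.piFinset t := by
    ext ω
    simp only [Finset.mem_filter, Finset.mem_univ, true_and, Fintype.mem_piFinset, Finset.ext_iff,
      mem_supp]
    refine forall_congr' fun v => ?_
    by_cases hv : v ∈ S <;> simp [ht, hv]
  have h2 : ∀ ω ∈ (Finset.univ : Finset (V → H)).filter (fun ω => supp ω = S),
      ∏ v ∈ supp ω, u (ω v) = ∏ v, f v (ω v) := by
    intro ω hω
    rw [(Finset.mem_filter.1 hω).2]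
    simp [hf, Finset.prod_ite_mem]
  rw [Finset.sum_congr rfl h2, h1, ← Finset.prod_univ_sum]
  have h3 : ∀ v, ∑ x ∈ t v, f v x =
      if v ∈ S then ∑ x ∈ (Finset.univ : Finset H).erase 0, u x else 1 := by
    intro v
    by_cases hv : v ∈ S <;> simp [ht, hf, hv]
  simp only [h3]
  simp [Finset.prod_ite_mem]

/-- Summation of a Peierls weight over connected configurations at `e`, when small ones (with fewer
than `R` vertices) carry an extra factor `A`. -/
lemma sum_connected_le [DecidableEq H] {W : (V → H) → ℝ} (nbr : V → Finset V)
    (hnbr : ∀ a b, adj a b → b ∈ nbr a) (hΔ : ∀ a, (nbr a).card ≤ 24) (e : V)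
    (bad : (V → H) → Prop) (hbad : ¬ bad 0) (u : H → ℝ) (hu : ∀ x, 0 ≤ u x) {A y : ℝ} {R : ℕ}
    (hA : 0 ≤ A) (hy : ∑ x ∈ (Finset.univ : Finset H).erase 0, u x = y) (hy1 : 96 * y ≤ 1)
    (hW : ∀ ω, cluster adj {e} (supp ω) = supp ω → bad ω →
      W ω ≤ (A + if R ≤ (supp ω).card then 1 else 0) * ∏ v ∈ supp ω, u (ω v)) :
    ∑ ω ∈ (Finset.univ : Finset (V → H)).filter
        (fun ω => cluster adj {e} (supp ω) = supp ω ∧ bad ω), W ω ≤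
      A * (96 * y) + (96 * y) ^ R := by
  have hy0 : 0 ≤ y := hy ▸ Finset.sum_nonneg fun x _ => hu x
  set 𝒮 := (Finset.univ : Finset (Finset V)).filter
    (fun S => cluster adj {e} S = S ∧ S.Nonempty) with h𝒮
  have hc : ∀ m : ℕ, 0 ≤ A + (if R ≤ m then (1 : ℝ) else 0) := fun m => by
    split_ifs <;> positivity
  have hterm : ∀ ω : V → H, 0 ≤ (A + if R ≤ (supp ω).card then 1 else 0) *
      ∏ v ∈ supp ω, u (ω v) := fun ω =>
    mul_nonneg (hc _) (Finset.prod_nonneg fun v _ => hu _)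
  have hmaps : ∀ ω ∈ (Finset.univ : Finset (V → H)).filter
      (fun ω => cluster adj {e} (supp ω) = supp ω ∧ bad ω), supp ω ∈ 𝒮 := by
    intro ω hω
    obtain ⟨-, h1, h2⟩ := Finset.mem_filter.1 hω
    refine Finset.mem_filter.2 ⟨Finset.mem_univ _, h1, ?_⟩
    rw [Finset.nonempty_iff_ne_empty]
    intro h0
    refine hbad ?_
    have : ω = 0 := by
      funext v
      by_contra hv
      have := mem_supp.2 hv
      rw [h0] at this
      exact absurd this (Finset.notMem_empty v)
    exact this ▸ h2
  have hS : ∀ S ∈ 𝒮, (A + if R ≤ S.card then 1 else 0) * y ^ S.card ≤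
      (A * (96 * y) + (96 * y) ^ R) * (1 / 96) ^ S.card := by
    intro S hS
    have hne : S.card ≠ 0 := (Finset.card_pos.2 (Finset.mem_filter.1 hS).2.2).ne'
    -- One of the small factors `96 y` (or `R` of them) is kept, the sum over `S` uses `1 / 96`.
    have h1 : y ^ S.card = (96 * y) ^ S.card * (1 / 96) ^ S.card := by
      rw [← mul_pow]; congr 1; ring
    rw [h1, ← mul_assoc]
    refine mul_le_mul_of_nonneg_right ?_ (by positivity)
    rw [add_mul]
    refine add_le_add (mul_le_mul_of_nonneg_left
      (pow_le_of_le_one (by positivity) hy1 hne) hA) ?_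
    split_ifs with hR
    · rw [one_mul]
      exact pow_le_pow_of_le_one (by positivity) hy1 hR
    · rw [zero_mul]; positivity
  calc _ ≤ ∑ ω ∈ (Finset.univ : Finset (V → H)).filter
          (fun ω => cluster adj {e} (supp ω) = supp ω ∧ bad ω),
          (A + if R ≤ (supp ω).card then 1 else 0) * ∏ v ∈ supp ω, u (ω v) :=
        Finset.sum_le_sum fun ω hω => by
          obtain ⟨-, h1, h2⟩ := Finset.mem_filter.1 hω
          exact hW ω h1 h2
    _ ≤ ∑ ω ∈ (Finset.univ : Finset (V → H)).filter (fun ω => supp ω ∈ 𝒮),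
          (A + if R ≤ (supp ω).card then 1 else 0) * ∏ v ∈ supp ω, u (ω v) :=
        Finset.sum_le_sum_of_subset_of_nonneg
          (fun ω hω => Finset.mem_filter.2 ⟨Finset.mem_univ _, hmaps ω hω⟩)
          fun ω _ _ => hterm ω
    _ = ∑ S ∈ 𝒮, ∑ ω ∈ (Finset.univ : Finset (V → H)).filter (fun ω => supp ω = S),
          (A + if R ≤ (supp ω).card then 1 else 0) * ∏ v ∈ supp ω, u (ω v) := by
        rw [← Finset.sum_fiberwise_of_maps_to (t := 𝒮) (g := supp)
          fun ω hω => (Finset.mem_filter.1 hω).2]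
        refine Finset.sum_congr rfl fun S hS => Finset.sum_congr ?_ fun _ _ => rfl
        ext ω
        simp only [Finset.mem_filter, Finset.mem_univ, true_and]
        exact ⟨fun h => h.2, fun h => ⟨h ▸ hS, h⟩⟩
    _ = ∑ S ∈ 𝒮, (A + if R ≤ S.card then 1 else 0) * y ^ S.card := by
        refine Finset.sum_congr rfl fun S _ => ?_
        rw [← hy, ← sum_prod_of_supp_eq u S, Finset.mul_sum]
        refine Finset.sum_congr rfl fun ω hω => ?_
        rw [(Finset.mem_filter.1 hω).2]
    _ ≤ ∑ S ∈ 𝒮, (A * (96 * y) + (96 * y) ^ R) * (1 / 96) ^ S.card := Finset.sum_le_sum hS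
    _ = (A * (96 * y) + (96 * y) ^ R) * ∑ S ∈ 𝒮, (1 / 96 : ℝ) ^ S.card :=
        (Finset.mul_sum _ _ _).symm
    _ ≤ _ := mul_le_of_le_one_right (by positivity) (sum_cluster_inv_pow_le_one nbr hnbr hΔ e)

/-- The expectation of `h` with respect to the probability measure proportional to `W`. -/
def gibbsExp (W : (V → G) → ℝ) (h : (V → G) → ℂ) : ℂ :=
  (∑ τ, (W τ : ℂ) * h τ) / ((∑ τ, W τ : ℝ) : ℂ)

/-- Comparison of two local weights. If a connected pair of configurations at `e ∈ Γ` on which the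
weights disagree has weight at most `A + 1_{size ≥ R}` times a product of single-site weights, whose
sum `y` over the nonzero values is small, then the expectations of an observable depending on `Γ`
differ by at most `2 |Γ| (96 y A + (96 y) ^ R)`. -/
theorem norm_gibbsExp_sub_le [DecidableEq G] {W₁ W₂ : (V → G) → ℝ} (hW₁ : IsLocalWeight adj W₁)
    (hW₂ : IsLocalWeight adj W₂) (hadj : ∀ a b, adj a b → adj b a) (nbr : V → Finset V)
    (hnbr : ∀ a b, adj a b → b ∈ nbr a) (hΔ : ∀ a, (nbr a).card ≤ 24) (Γ : Finset V)
    (h : (V → G) → ℂ) (hΓ : ∀ τ τ', (∀ v ∈ Γ, τ v = τ' v) → h τ = h τ') (hh : ∀ τ, ‖h τ‖ ≤ 1)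
    (u : G × G → ℝ) (hu : ∀ x, 0 ≤ u x) {A y : ℝ} {R : ℕ}
    (hA : 0 ≤ A) (hy : ∑ x ∈ (Finset.univ : Finset (G × G)).erase 0, u x = y) (hy1 : 96 * y ≤ 1)
    (hbad : ∀ e ∈ Γ, ∀ ω : V → G × G, cluster adj {e} (supp ω) = supp ω → ¬ Agree W₁ W₂ ω →
      pairWeight W₁ W₂ ω ≤
        (A + if R ≤ (supp ω).card then 1 else 0) * ∏ v ∈ supp ω, u (ω v)) :
    ‖gibbsExp W₁ h - gibbsExp W₂ h‖ ≤ 2 * Γ.card * (A * (96 * y) + (96 * y) ^ R) := by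
  have hpos : ∀ {W : (V → G) → ℝ}, IsLocalWeight adj W → 0 < ∑ τ, W τ := by
    intro W hW
    refine lt_of_lt_of_le one_pos ?_
    rw [← hW.map_zero]
    exact Finset.single_le_sum (f := W) (fun τ _ => hW.nonneg τ) (Finset.mem_univ _)
  have hZ₁ := hpos hW₁
  have hZ₂ := hpos hW₂
  set Z₁ := ∑ τ, W₁ τ with hZ₁d
  set Z₂ := ∑ τ, W₂ τ with hZ₂d
  have hpair : ∀ F : (V → G) → (V → G) → ℂ,
      ∑ ω : V → G × G, F (fun v => (ω v).1) (fun v => (ω v).2) = ∑ τ, ∑ τ', F τ τ' := by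
    intro F
    rw [← Fintype.sum_prod_type']
    exact Fintype.sum_equiv (Equiv.arrowProdEquivProdArrow V (fun _ => G) (fun _ => G)) _ _
      fun _ => rfl
  have hZ : ∑ ω, pairWeight W₁ W₂ ω = Z₁ * Z₂ := by
    have := hpair fun τ τ' => ((W₁ τ * W₂ τ' : ℝ) : ℂ)
    rw [hZ₁d, hZ₂d, Finset.sum_mul_sum]
    exact_mod_cast this
  have hdiff : gibbsExp W₁ h - gibbsExp W₂ h =
      (∑ ω : V → G × G, (pairWeight W₁ W₂ ω : ℂ) *
        (h (fun v => (ω v).1) - h fun v => (ω v).2)) / ((Z₁ * Z₂ : ℝ) : ℂ) := by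
    have := hpair fun τ τ' => ((W₁ τ * W₂ τ' : ℝ) : ℂ) * (h τ - h τ')
    simp only [pairWeight]
    rw [this]
    have hz1 : (Z₁ : ℂ) ≠ 0 := by exact_mod_cast hZ₁.ne'
    have hz2 : (Z₂ : ℂ) ≠ 0 := by exact_mod_cast hZ₂.ne'
    have e1 : ∑ τ, ∑ τ', ((W₁ τ * W₂ τ' : ℝ) : ℂ) * (h τ - h τ') =
        (∑ τ, (W₁ τ : ℂ) * h τ) * (Z₂ : ℂ) - (Z₁ : ℂ) * ∑ τ, (W₂ τ : ℂ) * h τ := by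
      rw [hZ₁d, hZ₂d]
      push_cast
      rw [Finset.sum_mul_sum, Finset.sum_mul_sum, ← Finset.sum_sub_distrib]
      refine Finset.sum_congr rfl fun τ _ => ?_
      rw [← Finset.sum_sub_distrib]
      exact Finset.sum_congr rfl fun τ' _ => by ring
    rw [e1, gibbsExp, gibbsExp, ← hZ₁d, ← hZ₂d]
    push_cast
    field_simp
  have hP := hW₁.pairWeight hW₂
  have hagree0 : ¬ ¬ Agree W₁ W₂ (0 : V → G × G) := by
    have : Agree W₁ W₂ (0 : V → G × G) :=
      ⟨hW₁.map_zero.trans hW₂.map_zero.symm, hW₁.map_zero.trans hW₂.map_zero.symm⟩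
    exact not_not.2 this
  have hZZ : 0 < Z₁ * Z₂ := mul_pos hZ₁ hZ₂
  rw [hdiff, norm_div, Complex.norm_real, Real.norm_of_nonneg hZZ.le, div_le_iff₀ hZZ]
  refine (norm_sum_pairWeight_mul_sub_le hW₁ hW₂ hadj Γ h hΓ hh).trans ?_
  calc _ ≤ ∑ e ∈ Γ, 2 * ((A * (96 * y) + (96 * y) ^ R) * (Z₁ * Z₂)) := by
        refine Finset.sum_le_sum fun e he => mul_le_mul_of_nonneg_left ?_ (by norm_num)
        refine (le_of_eq (by congr!)).trans
          ((sum_bad_cluster_le hP e fun ω => ¬ Agree W₁ W₂ ω).trans ?_)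
        rw [hZ]
        exact mul_le_mul_of_nonneg_right (sum_connected_le nbr hnbr hΔ e _ hagree0 u hu hA hy hy1
          (hbad e he)) hZZ.le
    _ = _ := by rw [Finset.sum_const, nsmul_eq_mul]; ring

end LocalWeight

/-! ### Plaquettes and adjacent edges -/

/-- The four edges in the boundary of a plaquette. -/
def plaqEdges (p : PosPlaq) : Finset PosEdge :=
  {(p.1, p.2.1.1), (p.1 + unit p.2.1.1, p.2.1.2), (p.1 + unit p.2.1.2, p.2.1.1), (p.1, p.2.1.2)}

/-- Two edges are adjacent if they lie in the boundary of a common plaquette. -/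
def EdgeAdj (e e' : PosEdge) : Prop := ∃ p, e ∈ plaqEdges p ∧ e' ∈ plaqEdges p

lemma EdgeAdj.symm {e e' : PosEdge} (h : EdgeAdj e e') : EdgeAdj e' e := by
  obtain ⟨p, h1, h2⟩ := h
  exact ⟨p, h2, h1⟩

/-- A set of edges containing those adjacent to `e`: they are listed by the second direction `k` of
the common plaquette. -/
def edgeNbr (e : PosEdge) : Finset PosEdge :=
  (Finset.univ : Finset (Fin 4 × Fin 6)).image fun t =>
    (![(e.1 + unit t.1, e.2), (e.1 - unit t.1, e.2), (e.1, t.1), (e.1 - unit t.1, t.1),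
      (e.1 + unit e.2, t.1), (e.1 + unit e.2 - unit t.1, t.1)] : Fin 6 → PosEdge) t.2

lemma card_edgeNbr_le (e : PosEdge) : (edgeNbr e).card ≤ 24 :=
  Finset.card_image_le.trans (by simp)

lemma EdgeAdj.mem_edgeNbr {e e' : PosEdge} (h : EdgeAdj e e') : e' ∈ edgeNbr e := by
  obtain ⟨⟨c, ⟨⟨i, j⟩, hij⟩⟩, h1, h2⟩ := h
  simp only [plaqEdges, Finset.mem_insert, Finset.mem_singleton] at h1 h2
  rw [edgeNbr, Finset.mem_image]
  rcases h1 with rfl | rfl | rfl | rfl <;> rcases h2 with rfl | rfl | rfl | rfl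
  · exact ⟨(i, 2), Finset.mem_univ _, rfl⟩
  · exact ⟨(j, 4), Finset.mem_univ _, rfl⟩
  · exact ⟨(j, 0), Finset.mem_univ _, rfl⟩
  · exact ⟨(j, 2), Finset.mem_univ _, rfl⟩
  · exact ⟨(i, 3), Finset.mem_univ _, by simp⟩
  · exact ⟨(j, 2), Finset.mem_univ _, rfl⟩
  · exact ⟨(i, 5), Finset.mem_univ _, by simp; abel⟩
  · exact ⟨(i, 1), Finset.mem_univ _, by simp⟩
  · exact ⟨(j, 1), Finset.mem_univ _, by simp⟩
  · exact ⟨(j, 5), Finset.mem_univ _, by simp; abel⟩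
  · exact ⟨(i, 2), Finset.mem_univ _, rfl⟩
  · exact ⟨(j, 3), Finset.mem_univ _, by simp⟩
  · exact ⟨(i, 2), Finset.mem_univ _, rfl⟩
  · exact ⟨(i, 0), Finset.mem_univ _, rfl⟩
  · exact ⟨(i, 4), Finset.mem_univ _, rfl⟩
  · exact ⟨(j, 2), Finset.mem_univ _, rfl⟩

/-- The sup norm of the base point of an edge. -/
def edgeNorm (e : PosEdge) : ℕ := Finset.univ.sup fun t => (e.1 t).natAbs

lemma edgeNorm_le_iff {e : PosEdge} {m : ℕ} :
    edgeNorm e ≤ m ↔ ∀ t, -(m : ℤ) ≤ e.1 t ∧ e.1 t ≤ m := by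
  simp only [edgeNorm, Finset.sup_le_iff, Finset.mem_univ, true_imp_iff]
  exact forall_congr' fun t => by omega

lemma unit_nonneg_le_one (i t : Fin 4) : 0 ≤ unit i t ∧ unit i t ≤ 1 := by
  by_cases h : t = i
  · subst h; simp [unit]
  · simp [unit, h]

lemma base_of_mem_plaqEdges {e : PosEdge} {p : PosPlaq} (h : e ∈ plaqEdges p) (t : Fin 4) :
    p.1 t ≤ e.1 t ∧ e.1 t ≤ p.1 t + 1 := by
  have h1 := unit_nonneg_le_one p.2.1.1 t
  have h2 := unit_nonneg_le_one p.2.1.2 t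
  simp only [plaqEdges, Finset.mem_insert, Finset.mem_singleton] at h
  rcases h with rfl | rfl | rfl | rfl <;> simp only [Pi.add_apply] <;> omega

lemma EdgeAdj.edgeNorm_le {e e' : PosEdge} (h : EdgeAdj e e') : edgeNorm e' ≤ edgeNorm e + 1 := by
  obtain ⟨p, h1, h2⟩ := h
  have h0 := edgeNorm_le_iff.1 (le_refl (edgeNorm e))
  refine edgeNorm_le_iff.2 fun t => ?_
  have := h0 t
  have := base_of_mem_plaqEdges h1 t
  have := base_of_mem_plaqEdges h2 t
  push_cast
  omega

lemma mem_box {N : ℕ} {a : Site} : a ∈ box N ↔ ∀ t, -(N : ℤ) ≤ a t ∧ a t ≤ N := by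
  simp [box, Fintype.mem_piFinset]

lemma mem_edges {N : ℕ} {e : PosEdge} :
    e ∈ edges N ↔ e.1 ∈ box N ∧ e.1 + unit e.2 ∈ box N := by
  simp [edges]

lemma mem_plaqs {N : ℕ} {p : PosPlaq} :
    p ∈ plaqs N ↔ p.1 ∈ box N ∧ p.1 + unit p.2.1.1 ∈ box N ∧ p.1 + unit p.2.1.2 ∈ box N ∧
      p.1 + unit p.2.1.1 + unit p.2.1.2 ∈ box N := by
  simp [plaqs]

lemma box_mono {N M : ℕ} (h : N ≤ M) : box N ⊆ box M := by
  intro a ha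
  rw [mem_box] at ha ⊢
  intro t
  have := ha t
  omega

lemma edges_mono {N M : ℕ} (h : N ≤ M) : edges N ⊆ edges M := by
  intro e he
  rw [mem_edges] at he ⊢
  exact ⟨box_mono h he.1, box_mono h he.2⟩

lemma plaqs_mono {N M : ℕ} (h : N ≤ M) : plaqs N ⊆ plaqs M := by
  intro p hp
  rw [mem_plaqs] at hp ⊢
  exact ⟨box_mono h hp.1, box_mono h hp.2.1, box_mono h hp.2.2.1, box_mono h hp.2.2.2⟩

lemma mem_edges_of_mem_plaqEdges {N : ℕ} {p : PosPlaq} (hp : p ∈ plaqs N) {e : PosEdge}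
    (he : e ∈ plaqEdges p) : e ∈ edges N := by
  obtain ⟨h1, h2, h3, h4⟩ := mem_plaqs.1 hp
  simp only [plaqEdges, Finset.mem_insert, Finset.mem_singleton] at he
  rw [mem_edges]
  rcases he with rfl | rfl | rfl | rfl
  · exact ⟨h1, h2⟩
  · exact ⟨h2, h4⟩
  · exact ⟨h3, by rwa [add_right_comm]⟩
  · exact ⟨h1, h3⟩

lemma mem_plaqs_of_edgeNorm_le {N : ℕ} {e : PosEdge} (he : edgeNorm e + 2 ≤ N) {p : PosPlaq}
    (hp : e ∈ plaqEdges p) : p ∈ plaqs N := by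
  have h0 := edgeNorm_le_iff.1 (le_refl (edgeNorm e))
  rw [mem_plaqs]
  refine ⟨?_, ?_, ?_, ?_⟩ <;>
  · rw [mem_box]
    intro t
    have := h0 t
    have := base_of_mem_plaqEdges hp t
    have := unit_nonneg_le_one p.2.1.1 t
    have := unit_nonneg_le_one p.2.1.2 t
    try simp only [Pi.add_apply]
    omega

lemma mem_edges_of_edgeNorm_le {N : ℕ} {e : PosEdge} (he : edgeNorm e + 2 ≤ N) : e ∈ edges N := by
  have h0 := edgeNorm_le_iff.1 (le_refl (edgeNorm e))
  rw [mem_edges, mem_box, mem_box]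
  refine ⟨fun t => ?_, fun t => ?_⟩ <;>
  · have := h0 t
    have := unit_nonneg_le_one e.2 t
    try simp only [Pi.add_apply]
    omega

/-! ### The exterior derivative and the size of vortices -/

section Curl

variable {G : Type*} [AddCommGroup G]

/-- The exterior derivative of a 1-form on `ℤ⁴` on the unit square at `a` spanned by `e_i` and
`e_j`. -/
def curl (x : PosEdge → G) (i j : Fin 4) (a : Site) : G :=
  x (a, i) + x (a + unit i, j) - x (a + unit j, i) - x (a, j)

/-- The exterior derivative of a 1-form on `ℤ⁴` on a positively oriented plaquette. -/
def curlAt (x : PosEdge → G) (p : PosPlaq) : G := curl x p.2.1.1 p.2.1.2 p.1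

lemma curlAt_congr {x y : PosEdge → G} {p : PosPlaq} (h : ∀ e ∈ plaqEdges p, x e = y e) :
    curlAt x p = curlAt y p := by
  simp only [plaqEdges, Finset.mem_insert, Finset.mem_singleton, forall_eq_or_imp,
    forall_eq] at h
  simp only [curlAt, curl, h.1, h.2.1, h.2.2.1, h.2.2.2]

lemma curlAt_eq_zero {x : PosEdge → G} {p : PosPlaq} (h : ∀ e ∈ plaqEdges p, x e = 0) :
    curlAt x p = 0 := by
  rw [curlAt_congr (y := 0) h]
  simp [curlAt, curl]

lemma curl_antisymm (x : PosEdge → G) (i j : Fin 4) (a : Site) : curl x j i a = - curl x i j a := by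
  simp only [curl]
  abel

/-- The Bianchi identity: the exterior derivative of an exact 2-form vanishes. -/
lemma curl_add_unit_sub (x : PosEdge → G) (i j k : Fin 4) (a : Site) :
    curl x i j (a + unit k) - curl x i j a =
      (curl x i k (a + unit j) - curl x i k a) - (curl x j k (a + unit i) - curl x j k a) := by
  simp only [curl, add_right_comm a (unit k) (unit i), add_right_comm a (unit k) (unit j),
    add_right_comm a (unit j) (unit i)]
  abel

/-- If the `(i, j)`-component of `dx` does not vanish, then the `(i, k)`- and `(j, k)`-components
have together at least two nonzero values: the Bianchi identity gives one just above the
highest point of the `(i, j)`-component in direction `k`, and one just below the lowest point. -/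
lemma two_le_card_curl_ne_zero {x : PosEdge → G} {A : Fin 4 → Fin 4 → Finset Site}
    (hA : ∀ i j, i ≠ j → ∀ a, a ∈ A i j ↔ curl x i j a ≠ 0) {i j k : Fin 4} (hij : i ≠ j)
    (hik : i ≠ k) (hjk : j ≠ k) (hne : (A i j).Nonempty) :
    2 ≤ (A i k).card + (A j k).card := by
  obtain ⟨b, hb, hmax⟩ := Finset.exists_max_image (A i j) (fun a => a k) hne
  obtain ⟨b', hb', hmin⟩ := Finset.exists_min_image (A i j) (fun a => a k) hne
  have hle : b' k ≤ b k := hmax b' hb'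
  have hkk : unit k k = 1 := by simp [unit]
  have hki : unit i k = 0 := by simp [unit, hik.symm]
  have hkj : unit j k = 0 := by simp [unit, hjk.symm]
  have key : ∀ a : Site, curl x i j (a + unit k) - curl x i j a ≠ 0 →
      ∃ c : Site, c k = a k ∧ (c ∈ A i k ∨ c ∈ A j k) := by
    intro a ha
    by_contra! hcon
    have h1 : ∀ c : Site, c k = a k → curl x i k c = 0 ∧ curl x j k c = 0 := by
      intro c hc
      have := hcon c hc
      rw [hA i k hik, hA j k hjk, not_not, not_not] at this
      exact this
    apply ha
    rw [curl_add_unit_sub, (h1 a rfl).1, (h1 a rfl).2, (h1 (a + unit j) (by simp [hkj])).1,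
      (h1 (a + unit i) (by simp [hki])).2]
    simp
  have htop : curl x i j (b + unit k) = 0 := by
    by_contra h0
    have := hmax _ ((hA i j hij _).2 h0)
    simp [hkk] at this
  have hbot : curl x i j (b' - unit k) = 0 := by
    by_contra h0
    have := hmin _ ((hA i j hij _).2 h0)
    simp [hkk] at this
  obtain ⟨c, hc, hc'⟩ := key b (by
    rw [htop, zero_sub]
    exact neg_ne_zero.2 ((hA i j hij b).1 hb))
  obtain ⟨d, hd, hd'⟩ := key (b' - unit k) (by
    rw [hbot, sub_zero, sub_add_cancel]
    exact (hA i j hij b').1 hb')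
  have hcd : c ≠ d := by
    rintro rfl
    rw [hc, Pi.sub_apply, hkk] at hd
    omega
  rcases hc' with hc' | hc' <;> rcases hd' with hd' | hd'
  · have := Finset.one_lt_card.2 ⟨c, hc', d, hd', hcd⟩
    omega
  · have := Finset.card_pos.2 ⟨c, hc'⟩
    have := Finset.card_pos.2 ⟨d, hd'⟩
    omega
  · have := Finset.card_pos.2 ⟨c, hc'⟩
    have := Finset.card_pos.2 ⟨d, hd'⟩
    omega
  · have := Finset.one_lt_card.2 ⟨c, hc', d, hd', hcd⟩
    omega

open Classical in
/-- If the exterior derivative of a 1-form on `ℤ⁴` is nonzero and finitely supported, then its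
support contains at least six plaquettes. -/
theorem six_le_card_curlAt_ne_zero {x : PosEdge → G} {P : Finset PosPlaq}
    (hP : ∀ p, curlAt x p ≠ 0 → p ∈ P) {p₀ : PosPlaq} (h₀ : curlAt x p₀ ≠ 0) :
    6 ≤ (P.filter fun p => curlAt x p ≠ 0).card := by
  set B : Fin 4 → Fin 4 → Finset Site := fun i j =>
    (P.image Prod.fst).filter fun a => curl x i j a ≠ 0 with hBdef
  have hB : ∀ i j, i ≠ j → ∀ a, a ∈ B i j ↔ curl x i j a ≠ 0 := by
    intro i j hij a
    refine ⟨fun h => (Finset.mem_filter.1 h).2, fun h => Finset.mem_filter.2 ⟨?_, h⟩⟩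
    rcases lt_or_gt_of_ne hij with hlt | hlt
    · exact Finset.mem_image.2 ⟨(a, ⟨(i, j), hlt⟩), hP (a, ⟨(i, j), hlt⟩) h, rfl⟩
    · refine Finset.mem_image.2 ⟨(a, ⟨(j, i), hlt⟩), hP (a, ⟨(j, i), hlt⟩) ?_, rfl⟩
      rw [curlAt, curl_antisymm]
      exact neg_ne_zero.2 h
  have hsymm : ∀ i j, B i j = B j i := by
    intro i j
    simp only [hBdef]
    refine Finset.filter_congr fun a _ => ?_
    rw [curl_antisymm, neg_ne_zero]
  have hcard : (P.filter fun p => curlAt x p ≠ 0).card =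
      ∑ q : Plane, (B q.1.1 q.1.2).card := by
    rw [Finset.card_eq_sum_card_fiberwise (f := Prod.snd) (t := Finset.univ)
      fun _ _ => Finset.mem_coe.2 (Finset.mem_univ _)]
    refine Finset.sum_congr rfl fun q _ => ?_
    refine Finset.card_bij (fun p _ => p.1) ?_ ?_ ?_
    · rintro ⟨a, q'⟩ hp
      obtain ⟨hp1, rfl⟩ := Finset.mem_filter.1 hp
      exact (hB _ _ q'.2.ne _).2 (Finset.mem_filter.1 hp1).2
    · rintro ⟨a, q₁⟩ hp ⟨a', q₂⟩ hp' h
      obtain ⟨-, h1⟩ := Finset.mem_filter.1 hp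
      obtain ⟨-, h2⟩ := Finset.mem_filter.1 hp'
      exact Prod.ext h (h1.trans h2.symm)
    · intro a ha
      have hne := (hB _ _ q.2.ne _).1 ha
      exact ⟨(a, q), Finset.mem_filter.2
        ⟨Finset.mem_filter.2 ⟨hP (a, q) hne, hne⟩, rfl⟩, rfl⟩
  have huniv : (Finset.univ : Finset Plane) =
      {⟨(0, 1), by decide⟩, ⟨(0, 2), by decide⟩, ⟨(0, 3), by decide⟩, ⟨(1, 2), by decide⟩,
        ⟨(1, 3), by decide⟩, ⟨(2, 3), by decide⟩} := by decide
  have hsum : ∑ q : Plane, (B q.1.1 q.1.2).card = (B 0 1).card + ((B 0 2).card +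
      ((B 0 3).card + ((B 1 2).card + ((B 1 3).card + (B 2 3).card)))) := by
    rw [huniv]
    repeat rw [Finset.sum_insert (by decide)]
    rw [Finset.sum_singleton]
  have hpos : 0 < ∑ q : Plane, (B q.1.1 q.1.2).card := by
    refine lt_of_lt_of_le (Finset.card_pos.2 ⟨p₀.1, (hB _ _ p₀.2.2.ne _).2 h₀⟩)
      (Finset.single_le_sum (f := fun q : Plane => (B q.1.1 q.1.2).card)
        (fun q _ => Nat.zero_le _) (Finset.mem_univ p₀.2))
  have two : ∀ i j k : Fin 4, i ≠ j → i ≠ k → j ≠ k → 0 < (B i j).card →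
      2 ≤ (B i k).card + (B j k).card := fun i j k hij hik hjk h =>
    two_le_card_curl_ne_zero hB hij hik hjk (Finset.card_pos.1 h)
  have t1 := two 0 1 2 (by decide) (by decide) (by decide)
  have t2 := two 0 1 3 (by decide) (by decide) (by decide)
  have t3 := two 0 2 1 (by decide) (by decide) (by decide)
  have t4 := two 0 2 3 (by decide) (by decide) (by decide)
  have t5 := two 0 3 1 (by decide) (by decide) (by decide)
  have t6 := two 0 3 2 (by decide) (by decide) (by decide)
  have t7 := two 1 2 0 (by decide) (by decide) (by decide)
  have t8 := two 1 2 3 (by decide) (by decide) (by decide)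
  have t9 := two 1 3 0 (by decide) (by decide) (by decide)
  have t10 := two 1 3 2 (by decide) (by decide) (by decide)
  have t11 := two 2 3 0 (by decide) (by decide) (by decide)
  have t12 := two 2 3 1 (by decide) (by decide) (by decide)
  rw [hsymm 2 1] at t3 t12
  rw [hsymm 3 1] at t5
  rw [hsymm 3 2] at t6 t10
  rw [hsymm 1 0, hsymm 2 0] at t7
  rw [hsymm 1 0, hsymm 3 0] at t9
  rw [hsymm 2 0, hsymm 3 0] at t11
  rw [hsymm 3 1] at t12
  rw [hcard]
  rw [hsum] at hpos ⊢
  clear hsum hcard huniv hsymm hB two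
  omega

end Curl

/-! ### Gibbs weights in unitary gauge -/

section GibbsWeight

open Classical

/-- The extension by zero of a function on a finite set. -/
def extend {ι G : Type*} [Zero G] {S : Finset ι} (ω : S → G) : ι → G :=
  fun i => if h : i ∈ S then ω ⟨i, h⟩ else 0

lemma extend_coe {ι G : Type*} [Zero G] {S : Finset ι} (ω : S → G) (i : S) :
    extend ω i = ω i := by
  simp [extend]

lemma extend_of_notMem {ι G : Type*} [Zero G] {S : Finset ι} (ω : S → G) {i : ι} (h : i ∉ S) :
    extend ω i = 0 := dif_neg h

lemma extend_restrict {ι G : Type*} [Zero G] {S : Finset ι} (ω : S → G) (T : Finset S) (i : ι) :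
    extend (restrict T ω) i = if ∃ h : i ∈ S, (⟨i, h⟩ : S) ∈ T then extend ω i else 0 := by
  by_cases h : i ∈ S <;> simp [extend, restrict, h]

variable {G : Type*} [AddCommGroup G] {N M : ℕ} {f f₁ f₂ g : G → ℝ}

/-- The weight of a 1-form on `B_N`, with plaquette factors `f` and edge factors `g`. -/
def boxWeight (N : ℕ) (f g : G → ℝ) (x : PosEdge → G) : ℝ :=
  (∏ p ∈ plaqs N, f (curlAt x p)) * ∏ e ∈ edges N, g (x e)

/-- The edge factor of an edge of a larger box: forms have to vanish on edges outside `B_N`. -/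
def edgeFactor (N : ℕ) (g : G → ℝ) (e : PosEdge) (z : G) : ℝ :=
  if e ∈ edges N then g z else if z = 0 then 1 else 0

/-- The Gibbs weight of `B_N` as a weight on 1-forms on a larger box `B_M`, supported on the forms
that vanish outside `B_N`. -/
def gibbsWeight (N M : ℕ) (f g : G → ℝ) (τ : edges M → G) : ℝ :=
  (∏ p ∈ plaqs N, f (curlAt (extend τ) p)) * ∏ e : edges M, edgeFactor N g e.1 (τ e)

/-- Admissible plaquette and edge factors. -/
structure IsFactorPair (f g : G → ℝ) : Prop where
  f_zero : f 0 = 1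
  f_nonneg : ∀ z, 0 ≤ f z
  f_le_one : ∀ z, f z ≤ 1
  g_zero : g 0 = 1
  g_nonneg : ∀ z, 0 ≤ g z

lemma edgeFactor_zero (hg : g 0 = 1) (e : PosEdge) : edgeFactor N g e 0 = 1 := by
  simp [edgeFactor, hg]

lemma edgeFactor_nonneg (hg : ∀ z, 0 ≤ g z) (e : PosEdge) (z : G) : 0 ≤ edgeFactor N g e z := by
  rw [edgeFactor]
  split_ifs
  exacts [hg z, zero_le_one, le_rfl]

lemma edgeFactor_le (h0 : g 0 = 1) (hg : ∀ z, 0 ≤ g z) (e : PosEdge) (z : G) :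
    edgeFactor N g e z ≤ g z := by
  rw [edgeFactor]
  split_ifs with h1 h2
  exacts [le_rfl, by rw [h2, h0], hg z]

/-- Adjacency of edges of the box. -/
def boxAdj (M : ℕ) (a b : edges M) : Prop := EdgeAdj a.1 b.1

lemma isLocalWeight_gibbsWeight (h : IsFactorPair f g) :
    IsLocalWeight (boxAdj M) (gibbsWeight N M f g) where
  nonneg τ := mul_nonneg (Finset.prod_nonneg fun p _ => h.f_nonneg _)
    (Finset.prod_nonneg fun e _ => edgeFactor_nonneg h.g_nonneg _ _)
  map_zero := by
    have h1 : extend (0 : edges M → G) = 0 := by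
      funext e
      simp [extend]
    have h2 : ∀ p, curlAt (0 : PosEdge → G) p = 0 := fun p => curlAt_eq_zero fun _ _ => rfl
    simp [gibbsWeight, h1, h2, h.f_zero, edgeFactor_zero h.g_zero]
  map_mul τ S hS := by
    rw [gibbsWeight, gibbsWeight, gibbsWeight, mul_mul_mul_comm, ← Finset.prod_mul_distrib,
      ← Finset.prod_mul_distrib]
    congr 1
    · refine Finset.prod_congr rfl fun p _ => ?_
      -- The edges of a plaquette are pairwise adjacent, so the nonzero ones are either all in `S`
      -- or all outside `S`.
      by_cases hp : ∃ e ∈ plaqEdges p, extend (restrict S τ) e ≠ 0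
      · obtain ⟨e, hep, he⟩ := hp
        rw [extend_restrict] at he
        have hcond := of_not_not fun hc => he (if_neg hc)
        rw [if_pos hcond] at he
        obtain ⟨heM, heS⟩ := hcond
        have hout : ∀ e' ∈ plaqEdges p, extend (restrict Sᶜ τ) e' = 0 := by
          intro e' hep'
          by_contra he'
          rw [extend_restrict] at he'
          have hcond' := of_not_not fun hc => he' (if_neg hc)
          rw [if_pos hcond'] at he'
          obtain ⟨heM', heS'⟩ := hcond'
          refine hS _ heS _ (Finset.mem_compl.1 heS') ?_ ?_ ⟨p, hep, hep'⟩
          · simpa [extend, heM] using he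
          · simpa [extend, heM'] using he'
        have hin : curlAt (extend (restrict S τ)) p = curlAt (extend τ) p := by
          refine curlAt_congr fun e' hep' => ?_
          have h0 := hout e' hep'
          by_cases heM' : e' ∈ edges M
          · by_cases heS' : (⟨e', heM'⟩ : edges M) ∈ S
            · simp [extend, restrict, heM', heS']
            · simpa [extend, restrict, heM', heS', eq_comm] using h0
          · simp [extend, heM']
        rw [hin, curlAt_eq_zero hout, h.f_zero, mul_one]
      · push Not at hp
        have hout : curlAt (extend (restrict Sᶜ τ)) p = curlAt (extend τ) p := by
          refine curlAt_congr fun e hep => ?_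
          have h0 := hp e hep
          by_cases heM : e ∈ edges M
          · by_cases heS : (⟨e, heM⟩ : edges M) ∈ S
            · simpa [extend, restrict, heM, heS, eq_comm] using h0
            · simp [extend, restrict, heM, heS]
          · simp [extend, heM]
        rw [hout, curlAt_eq_zero hp, h.f_zero, one_mul]
    · refine Finset.prod_congr rfl fun e _ => ?_
      by_cases he : e ∈ S <;> simp [restrict, he, edgeFactor_zero h.g_zero]

lemma gibbsWeight_le_mul_prod (h : IsFactorPair f g) {τ : edges M → G} {A : ℝ}
    (hA : ∏ p ∈ plaqs N, f (curlAt (extend τ) p) ≤ A) :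
    gibbsWeight N M f g τ ≤ A * ∏ e, g (τ e) := by
  have h1 : 0 ≤ ∏ e, edgeFactor N g e.1 (τ e) :=
    Finset.prod_nonneg fun e _ => edgeFactor_nonneg h.g_nonneg _ _
  refine mul_le_mul hA (Finset.prod_le_prod (fun e _ => edgeFactor_nonneg h.g_nonneg _ _)
    fun e _ => edgeFactor_le h.g_zero h.g_nonneg _ _) h1 ?_
  exact (Finset.prod_nonneg fun p _ => h.f_nonneg _).trans hA

lemma prod_curlAt_le_one (h : IsFactorPair f g) (x : PosEdge → G) :
    ∏ p ∈ plaqs N, f (curlAt x p) ≤ 1 :=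
  Finset.prod_le_one (fun _ _ => h.f_nonneg _) fun _ _ => h.f_le_one _

lemma gibbsWeight_le_prod (h : IsFactorPair f g) (τ : edges M → G) :
    gibbsWeight N M f g τ ≤ ∏ e, g (τ e) := by
  simpa using gibbsWeight_le_mul_prod h (prod_curlAt_le_one (N := N) h (extend τ))

/-- The edges where `τ` is nonzero keep distance 2 from the complement of `B_N`. -/
def IsInterior (N : ℕ) (τ : edges M → G) : Prop := ∀ e, τ e ≠ 0 → edgeNorm e.1 + 2 ≤ N

lemma IsInterior.mem_plaqs {τ : edges M → G} (hτ : IsInterior N τ) {p : PosPlaq}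
    (hp : curlAt (extend τ) p ≠ 0) : p ∈ plaqs N := by
  by_contra hpN
  refine hp (curlAt_eq_zero fun e he => ?_)
  by_contra h0
  have heM : e ∈ edges M := by
    by_contra hc
    exact h0 (extend_of_notMem τ hc)
  have := hτ ⟨e, heM⟩ fun hc => h0 ((extend_coe τ ⟨e, heM⟩).trans hc)
  exact hpN (mem_plaqs_of_edgeNorm_le this he)

lemma IsInterior.gibbsWeight_eq (hNM : N ≤ M) (h : IsFactorPair f g) {τ : edges M → G}
    (hτ : IsInterior N τ) : gibbsWeight N M f g τ = gibbsWeight M M f g τ := by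
  refine congrArg₂ (· * ·) ?_ ?_
  · refine Finset.prod_subset (plaqs_mono hNM) fun p _ hpN => ?_
    have : curlAt (extend τ) p = 0 := by
      by_contra h0
      exact hpN (hτ.mem_plaqs h0)
    rw [this, h.f_zero]
  · refine Finset.prod_congr rfl fun e _ => ?_
    by_cases he : τ e = 0
    · rw [he, edgeFactor_zero h.g_zero, edgeFactor_zero h.g_zero]
    · rw [edgeFactor, edgeFactor, if_pos (mem_edges_of_edgeNorm_le (hτ e he)), if_pos e.2]

lemma edgeNorm_add_two_le_of_cluster {H : Type*} [Zero H] {ω : edges M → H} {e : edges M} {R : ℕ}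
    (hω : cluster (boxAdj M) {e} (supp ω) = supp ω) (hR : (supp ω).card < R)
    (he : edgeNorm e.1 + R + 2 ≤ N) (v : edges M) (hv : ω v ≠ 0) : edgeNorm v.1 + 2 ≤ N := by
  have hv' : v ∈ cluster (boxAdj M) {e} (supp ω) := by
    rw [hω]
    exact mem_supp.2 hv
  have := lt_add_card_of_mem_cluster (fun v : edges M => edgeNorm v.1)
    (fun a b hab => EdgeAdj.edgeNorm_le hab) hv'
  omega

/-- A nonvanishing exterior derivative in the interior of the box costs at least six factors. -/
lemma IsInterior.prod_curlAt_le_pow_six (h : IsFactorPair f g) {α : ℝ} (hα0 : 0 ≤ α) (hα1 : α ≤ 1)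
    (hα : ∀ z, z ≠ 0 → f z ≤ α) {τ : edges M → G} (hτ : IsInterior N τ) {p₀ : PosPlaq}
    (hp₀ : curlAt (extend τ) p₀ ≠ 0) :
    ∏ p ∈ plaqs N, f (curlAt (extend τ) p) ≤ α ^ 6 := by
  have hsix := six_le_card_curlAt_ne_zero (fun p hp => hτ.mem_plaqs hp) hp₀
  calc _ ≤ ∏ p ∈ plaqs N, if curlAt (extend τ) p ≠ 0 then α else 1 := by
        refine Finset.prod_le_prod (fun p _ => h.f_nonneg _) fun p _ => ?_
        split_ifs with hp
        exacts [hα _ hp, h.f_le_one _]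
    _ = α ^ ((plaqs N).filter fun p => curlAt (extend τ) p ≠ 0).card := by
        rw [Finset.prod_ite, Finset.prod_const, Finset.prod_const_one, mul_one]
    _ ≤ α ^ 6 := pow_le_pow_of_le_one hα0 hα1 hsix

lemma prod_mul_prod_eq_prod_supp (hg : g 0 = 1) (ω : edges M → G × G) :
    (∏ e, g (ω e).1) * ∏ e, g (ω e).2 = ∏ e ∈ supp ω, g (ω e).1 * g (ω e).2 := by
  rw [← Finset.prod_mul_distrib]
  refine (Finset.prod_subset (Finset.subset_univ _) fun e _ he => ?_).symm
  have : ω e = 0 := by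
    by_contra h0
    exact he (mem_supp.2 h0)
  simp [this, hg]

lemma sum_erase_zero_prod [Fintype G] [DecidableEq G] (hg : g 0 = 1) :
    ∑ z ∈ (Finset.univ : Finset (G × G)).erase 0, g z.1 * g z.2 =
      (∑ z ∈ (Finset.univ : Finset G).erase 0, g z) *
        (2 + ∑ z ∈ (Finset.univ : Finset G).erase 0, g z) := by
  have h1 := Finset.add_sum_erase Finset.univ (fun z : G × G => g z.1 * g z.2)
    (Finset.mem_univ 0)
  have h2 := Finset.add_sum_erase Finset.univ g (Finset.mem_univ 0)
  have h3 : ∑ z : G × G, g z.1 * g z.2 = (∑ z, g z) * ∑ z, g z := by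
    rw [Finset.sum_mul_sum, ← Finset.sum_product']
    rfl
  rw [h3, ← h2] at h1
  simp only [Prod.fst_zero, Prod.snd_zero, hg] at h1
  linarith

section Comparison

variable [Fintype G] [DecidableEq G] {y : ℝ} {R : ℕ} {Γ : Finset PosEdge}
  {Ψ : (PosEdge → G) → ℂ}

/-- The general comparison estimate on boxes. -/
lemma norm_gibbsExp_sub_le_of_box {W₁ W₂ : (edges M → G) → ℝ} (hg0 : g 0 = 1)
    (hg : ∀ z, 0 ≤ g z) (hW₁ : IsLocalWeight (boxAdj M) W₁) (hW₂ : IsLocalWeight (boxAdj M) W₂)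
    (hy : (∑ z ∈ (Finset.univ : Finset G).erase 0, g z) *
      (2 + ∑ z ∈ (Finset.univ : Finset G).erase 0, g z) = y) (hy1 : 96 * y ≤ 1)
    (hle₁ : ∀ τ, W₁ τ ≤ ∏ e, g (τ e)) (hle₂ : ∀ τ, W₂ τ ≤ ∏ e, g (τ e))
    (hΨ : ∀ x x', (∀ e ∈ Γ, x e = x' e) → Ψ x = Ψ x') (hΨ1 : ∀ x, ‖Ψ x‖ ≤ 1) {A : ℝ} (hA : 0 ≤ A)
    (hΓ : ∀ e ∈ Γ, edgeNorm e + R + 2 ≤ N)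
    (hbad : ∀ ω : edges M → G × G, (∀ v, ω v ≠ 0 → edgeNorm v.1 + 2 ≤ N) →
      ¬ Agree W₁ W₂ ω →
      pairWeight W₁ W₂ ω ≤ A * ((∏ e, g (ω e).1) * ∏ e, g (ω e).2)) :
    ‖gibbsExp W₁ (fun τ => Ψ (extend τ)) - gibbsExp W₂ (fun τ => Ψ (extend τ))‖ ≤
      2 * Γ.card * (A * (96 * y) + (96 * y) ^ R) := by
  set Γ' : Finset (edges M) := Finset.univ.filter fun e => e.1 ∈ Γ with hΓ'
  have hcard : Γ'.card ≤ Γ.card :=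
    Finset.card_le_card_of_injOn Subtype.val (fun e he => (Finset.mem_filter.1 he).2)
      Subtype.val_injective.injOn
  have hy0 : 0 ≤ y := by
    have : 0 ≤ ∑ z ∈ (Finset.univ : Finset G).erase 0, g z := Finset.sum_nonneg fun z _ => hg z
    rw [← hy]
    positivity
  set nbr : edges M → Finset (edges M) := fun a => Finset.univ.filter fun b => b.1 ∈ edgeNbr a.1
  refine (norm_gibbsExp_sub_le (Γ := Γ') (A := A) (R := R) (y := y) hW₁ hW₂
    (fun a b hab => EdgeAdj.symm hab) nbr
    (fun a b hab => Finset.mem_filter.2 ⟨Finset.mem_univ _, EdgeAdj.mem_edgeNbr hab⟩)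
    (fun a => ?_) _ (fun τ τ' h => hΨ _ _ fun e he => ?_) (fun τ => hΨ1 _)
    (fun z => g z.1 * g z.2) (fun z => mul_nonneg (hg _) (hg _)) hA
    (by rw [sum_erase_zero_prod hg0, hy]) hy1 ?_).trans ?_
  · exact (Finset.card_le_card_of_injOn Subtype.val (fun e he => (Finset.mem_filter.1 he).2)
      Subtype.val_injective.injOn).trans (card_edgeNbr_le a.1)
  · by_cases heM : e ∈ edges M
    · simpa [extend, heM] using h ⟨e, heM⟩ (Finset.mem_filter.2 ⟨Finset.mem_univ _, he⟩)
    · simp [extend, heM]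
  · intro e he ω hω hdis
    have hprod : 0 ≤ ∏ v ∈ supp ω, g (ω v).1 * g (ω v).2 :=
      Finset.prod_nonneg fun v _ => mul_nonneg (hg _) (hg _)
    rw [← prod_mul_prod_eq_prod_supp hg0] at hprod ⊢
    split_ifs with hR
    · calc pairWeight W₁ W₂ ω ≤ (∏ e, g (ω e).1) * ∏ e, g (ω e).2 :=
            mul_le_mul (hle₁ _) (hle₂ _) (hW₂.nonneg _) (Finset.prod_nonneg fun e _ => hg _)
        _ ≤ _ := le_mul_of_one_le_left hprod (by linarith)
    · rw [add_zero]
      exact hbad ω (edgeNorm_add_two_le_of_cluster hω (not_le.1 hR)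
        (hΓ _ (Finset.mem_filter.1 he).2)) hdis
  · have : (Γ'.card : ℝ) ≤ Γ.card := by exact_mod_cast hcard
    have h0 : 0 ≤ A * (96 * y) + (96 * y) ^ R := by positivity
    gcongr

/-- Enlarging the box hardly changes the expectation of an observable in the bulk. -/
lemma norm_gibbsExp_box_sub_le (h : IsFactorPair f g) (hNM : N ≤ M)
    (hy : (∑ z ∈ (Finset.univ : Finset G).erase 0, g z) *
      (2 + ∑ z ∈ (Finset.univ : Finset G).erase 0, g z) = y) (hy1 : 96 * y ≤ 1)
    (hΨ : ∀ x x', (∀ e ∈ Γ, x e = x' e) → Ψ x = Ψ x') (hΨ1 : ∀ x, ‖Ψ x‖ ≤ 1)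
    (hΓ : ∀ e ∈ Γ, edgeNorm e + R + 2 ≤ N) :
    ‖gibbsExp (gibbsWeight N M f g) (fun τ => Ψ (extend τ)) -
      gibbsExp (gibbsWeight M M f g) (fun τ => Ψ (extend τ))‖ ≤ 2 * Γ.card * (96 * y) ^ R := by
  refine (norm_gibbsExp_sub_le_of_box h.g_zero h.g_nonneg (isLocalWeight_gibbsWeight h)
    (isLocalWeight_gibbsWeight h) hy hy1 (gibbsWeight_le_prod h) (gibbsWeight_le_prod h) hΨ hΨ1
    le_rfl hΓ fun ω hω hdis => absurd ?_ hdis).trans_eq (by rw [zero_mul, zero_add])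
  exact ⟨IsInterior.gibbsWeight_eq hNM h fun e he => hω e (ne_zero_of_fst he),
    IsInterior.gibbsWeight_eq hNM h fun e he => hω e (ne_zero_of_snd he)⟩

/-- Comparison of general plaquette factors with those forcing the exterior derivative to vanish:
two weights disagree only if the first form has nonvanishing exterior derivative. -/
lemma norm_gibbsExp_sub_closed_le (h : IsFactorPair f g) {α : ℝ} (hα0 : 0 ≤ α) (hα1 : α ≤ 1)
    (hα : ∀ z, z ≠ 0 → f z ≤ α)
    (hy : (∑ z ∈ (Finset.univ : Finset G).erase 0, g z) *
      (2 + ∑ z ∈ (Finset.univ : Finset G).erase 0, g z) = y) (hy1 : 96 * y ≤ 1)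
    (hΨ : ∀ x x', (∀ e ∈ Γ, x e = x' e) → Ψ x = Ψ x') (hΨ1 : ∀ x, ‖Ψ x‖ ≤ 1)
    (hΓ : ∀ e ∈ Γ, edgeNorm e + R + 2 ≤ N) :
    ‖gibbsExp (gibbsWeight N N f g) (fun τ => Ψ (extend τ)) -
      gibbsExp (gibbsWeight N N (fun z => if z = 0 then 1 else 0) g) (fun τ => Ψ (extend τ))‖ ≤
      2 * Γ.card * (α ^ 6 * (96 * y) + (96 * y) ^ R) := by
  set f₀ : G → ℝ := fun z => if z = 0 then 1 else 0 with hf₀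
  have h₀ : IsFactorPair f₀ g :=
    { f_zero := if_pos rfl
      f_nonneg := fun z => by simp only [hf₀]; split_ifs <;> norm_num
      f_le_one := fun z => by simp only [hf₀]; split_ifs <;> norm_num
      g_zero := h.g_zero
      g_nonneg := h.g_nonneg }
  have hclosed : ∀ τ : edges N → G, (∀ p ∈ plaqs N, curlAt (extend τ) p = 0) →
      gibbsWeight N N f g τ = gibbsWeight N N f₀ g τ := by
    intro τ hτ
    rw [gibbsWeight, gibbsWeight]
    congr 1
    exact Finset.prod_congr rfl fun p hp => by rw [hτ p hp, h.f_zero, h₀.f_zero]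
  refine norm_gibbsExp_sub_le_of_box h.g_zero h.g_nonneg (isLocalWeight_gibbsWeight h)
    (isLocalWeight_gibbsWeight h₀) hy hy1 (gibbsWeight_le_prod h) (gibbsWeight_le_prod h₀) hΨ hΨ1
    (by positivity) hΓ fun ω hω hdis => ?_
  have hg2 : 0 ≤ (∏ e, g (ω e).1) * ∏ e, g (ω e).2 :=
    mul_nonneg (Finset.prod_nonneg fun e _ => h.g_nonneg _)
      (Finset.prod_nonneg fun e _ => h.g_nonneg _)
  -- The second form is closed unless the pair has weight zero, so a disagreement is due to the
  -- first form.
  by_cases h2 : ∀ p ∈ plaqs N, curlAt (extend fun e => (ω e).2) p = 0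
  · have h1 : ∃ p ∈ plaqs N, curlAt (extend fun e => (ω e).1) p ≠ 0 := by
      by_contra! hcon
      exact hdis ⟨hclosed _ hcon, hclosed _ h2⟩
    obtain ⟨p₀, -, hp₀⟩ := h1
    have hint : IsInterior N fun e => (ω e).1 := fun e he => hω e (ne_zero_of_fst he)
    rw [← mul_assoc]
    exact mul_le_mul
      (gibbsWeight_le_mul_prod h (hint.prod_curlAt_le_pow_six h hα0 hα1 hα hp₀))
      (gibbsWeight_le_prod h₀ _) ((isLocalWeight_gibbsWeight h₀).nonneg _)
      (mul_nonneg (by positivity) (Finset.prod_nonneg fun e _ => h.g_nonneg _))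
  · push Not at h2
    obtain ⟨p, hp, hp0⟩ := h2
    have : gibbsWeight N N f₀ g (fun e => (ω e).2) = 0 := by
      rw [gibbsWeight, Finset.prod_eq_zero hp (if_neg hp0), zero_mul]
    rw [pairWeight, this, mul_zero]
    positivity

end Comparison

/-! ### Changing the ambient box -/

lemma gibbsWeight_eq_boxWeight (hNM : N ≤ M) (τ : edges M → G) :
    gibbsWeight N M f g τ =
      if ∀ e : edges M, e.1 ∉ edges N → τ e = 0 then boxWeight N f g (extend τ) else 0 := by
  split_ifs with h
  · rw [gibbsWeight, boxWeight]
    congr 1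
    have h1 : ∀ e : edges M, edgeFactor N g e.1 (τ e) =
        if e.1 ∈ edges N then g (extend τ e.1) else 1 := by
      intro e
      rw [edgeFactor, extend_coe]
      by_cases he : e.1 ∈ edges N
      · rw [if_pos he, if_pos he]
      · rw [if_neg he, if_neg he, if_pos (h e he)]
    rw [Finset.prod_congr rfl fun e _ => h1 e,
      Finset.prod_coe_sort (edges M) fun e => if e ∈ edges N then g (extend τ e) else 1,
      Finset.prod_ite_mem, Finset.inter_eq_right.2 (edges_mono hNM)]
  · push Not at h
    obtain ⟨e, he, h0⟩ := h
    rw [gibbsWeight, Finset.prod_eq_zero (Finset.mem_univ e), mul_zero]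
    rw [edgeFactor, if_neg he, if_neg h0]

lemma gibbsWeight_self (τ : edges N → G) :
    gibbsWeight N N f g τ = boxWeight N f g (extend τ) := by
  rw [gibbsWeight_eq_boxWeight le_rfl, if_pos fun e he => absurd e.2 he]

lemma sum_extend [Fintype G] (hNM : N ≤ M) (Φ : (PosEdge → G) → ℂ) :
    ∑ τ : edges M → G, (if ∀ e : edges M, e.1 ∉ edges N → τ e = 0 then Φ (extend τ) else 0) =
      ∑ σ : edges N → G, Φ (extend σ) := by
  have hext : ∀ σ : edges N → G, extend (fun e : edges M => extend σ e.1) = extend σ := by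
    intro σ
    funext e
    by_cases he : e ∈ edges M
    · exact extend_coe (fun e : edges M => extend σ e.1) ⟨e, he⟩
    · rw [extend_of_notMem _ he, extend_of_notMem _ fun h => he (edges_mono hNM h)]
  have hext' : ∀ τ : edges M → G, (∀ e : edges M, e.1 ∉ edges N → τ e = 0) →
      extend (fun e : edges N => extend τ e.1) = extend τ := by
    intro τ hτ
    funext e
    by_cases he : e ∈ edges N
    · exact extend_coe (fun e : edges N => extend τ e.1) ⟨e, he⟩
    · rw [extend_of_notMem _ he]
      by_cases heM : e ∈ edges M
      · rw [extend, dif_pos heM, hτ ⟨e, heM⟩ he]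
      · rw [extend_of_notMem _ heM]
  rw [← Finset.sum_filter]
  refine Finset.sum_bij' (fun τ _ => fun e : edges N => extend τ e.1)
    (fun σ _ => fun e : edges M => extend σ e.1) (fun _ _ => Finset.mem_univ _) ?_ ?_ ?_ ?_
  · intro σ _
    exact Finset.mem_filter.2 ⟨Finset.mem_univ _, fun e he => extend_of_notMem σ he⟩
  · intro τ hτ
    funext e
    rw [hext' τ (Finset.mem_filter.1 hτ).2, extend_coe]
  · intro σ _
    funext e
    rw [hext σ, extend_coe]
  · intro τ hτ
    rw [hext' τ (Finset.mem_filter.1 hτ).2]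

lemma gibbsExp_gibbsWeight_eq [Fintype G] (hNM : N ≤ M) (Ψ : (PosEdge → G) → ℂ) :
    gibbsExp (gibbsWeight N M f g) (fun τ => Ψ (extend τ)) =
      gibbsExp (gibbsWeight N N f g) (fun τ => Ψ (extend τ)) := by
  have h1 : ∀ Φ : (PosEdge → G) → ℂ,
      ∑ τ : edges M → G, (gibbsWeight N M f g τ : ℂ) * Φ (extend τ) =
        ∑ τ : edges N → G, (gibbsWeight N N f g τ : ℂ) * Φ (extend τ) := by
    intro Φ
    simp only [gibbsWeight_self]
    rw [← sum_extend hNM fun x => (boxWeight N f g x : ℂ) * Φ x]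
    refine Finset.sum_congr rfl fun τ _ => ?_
    rw [gibbsWeight_eq_boxWeight hNM]
    split_ifs <;> simp
  have h2 := h1 fun _ => 1
  simp only [mul_one] at h2
  rw [gibbsExp, gibbsExp, h1 Ψ]
  push_cast
  rw [h2]

end GibbsWeight

/-! ### Gauge fixing -/

section Gauge

open Classical

lemma onChain_eq_linearCombination {ι : Type} {n : ℕ} {S : Finset ι} (ω : Form n S) (q : ι →₀ ℤ) :
    ω.onChain q = Finsupp.linearCombination ℤ (extend ω) q := by
  have h1 : ω.onChain q = ∑ c ∈ S, q c • extend ω c := by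
    rw [← Finset.sum_coe_sort S fun c => q c • extend ω c]
    exact Finset.sum_congr rfl fun c _ => by rw [extend_coe]
  rw [h1, Finsupp.linearCombination_apply, Finsupp.sum_of_support_subset (s := S ∪ q.support) q
    Finset.subset_union_right (fun c k => k • extend ω c) fun _ _ => zero_smul ℤ _]
  refine Finset.sum_subset Finset.subset_union_left fun c _ hc => ?_
  rw [extend_of_notMem ω hc, smul_zero]

/-- The exterior derivative of a 0-form on `ℤ⁴`. -/
def grad {G : Type*} [AddCommGroup G] (ψ : Site → G) (e : PosEdge) : G :=
  ψ (e.1 + unit e.2) - ψ e.1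

lemma curlAt_add_grad {G : Type*} [AddCommGroup G] (x : PosEdge → G) (ψ : Site → G) (p : PosPlaq) :
    curlAt (x + grad ψ) p = curlAt x p := by
  simp only [curlAt, curl, grad, Pi.add_apply,
    add_right_comm p.1 (unit p.2.1.2) (unit p.2.1.1)]
  abel

variable {n N : ℕ}

lemma dOne_apply (σ : Form n (edges N)) (p : plaqs N) : dOne σ p = curlAt (extend σ) p.1 := by
  rw [dOne, onChain_eq_linearCombination]
  simp [plaqBoundary, curlAt, curl]

lemma onChain_edgeBoundary (φ : Form n (box N)) (e : PosEdge) :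
    φ.onChain (edgeBoundary e) = grad (extend φ) e := by
  rw [onChain_eq_linearCombination]
  simp [edgeBoundary, grad]

lemma onChain_chainBoundary (φ : Form n (box N)) (γ : PosEdge →₀ ℤ) :
    φ.onChain (chainBoundary γ) = Finsupp.linearCombination ℤ (grad (extend φ)) γ := by
  rw [onChain_eq_linearCombination, chainBoundary, map_finsuppSum, Finsupp.linearCombination_apply]
  refine Finsupp.sum_congr fun e _ => ?_
  rw [map_smul, ← onChain_eq_linearCombination, onChain_edgeBoundary]

/-- The gauge transformation of a gauge field by a 0-form. -/
def gaugeShift (φ : Form n (box N)) : Form n (edges N) := fun e => grad (extend φ) e.1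

lemma extend_add_gaugeShift (σ : Form n (edges N)) (φ : Form n (box N)) {e : PosEdge}
    (he : e ∈ edges N) :
    extend (σ + gaugeShift φ) e = (extend σ + grad (extend φ)) e := by
  simp [extend, gaugeShift, he]

lemma dOne_add_gaugeShift (σ : Form n (edges N)) (φ : Form n (box N)) :
    dOne (σ + gaugeShift φ) = dOne σ := by
  funext p
  rw [dOne_apply, dOne_apply, ← curlAt_add_grad (extend σ) (extend φ)]
  exact curlAt_congr fun e he =>
    extend_add_gaugeShift σ φ (mem_edges_of_mem_plaqEdges p.2 he)

section Weights

variable (ρ : AddChar (ZMod n) Circle)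

/-- The Wilson line observable in unitary gauge, for gauge fields on `ℤ⁴`. -/
def wilson (γ : PosEdge →₀ ℤ) (x : PosEdge → ZMod n) : ℂ :=
  (ρ (Finsupp.linearCombination ℤ x γ) : ℂ)

lemma wilson_congr {γ : PosEdge →₀ ℤ} {x x' : PosEdge → ZMod n}
    (h : ∀ e ∈ γ.support, x e = x' e) : wilson ρ γ x = wilson ρ γ x' := by
  rw [wilson, wilson, Finsupp.linearCombination_apply, Finsupp.linearCombination_apply]
  congr 2
  exact Finsupp.sum_congr fun e he => by rw [h e he]

lemma norm_wilson (γ : PosEdge →₀ ℤ) (x : PosEdge → ZMod n) : ‖wilson ρ γ x‖ ≤ 1 :=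
  (Circle.norm_coe _).le

lemma wilsonLine_add_gaugeShift {γ : PosEdge →₀ ℤ} (hγ : γ.support ⊆ edges N)
    (σ : Form n (edges N)) (φ : Form n (box N)) :
    wilsonLine ρ γ N (σ + gaugeShift φ) φ = wilson ρ γ (extend σ) := by
  rw [wilsonLine, wilson, onChain_chainBoundary, onChain_eq_linearCombination]
  congr 2
  rw [sub_eq_iff_eq_add]
  simp only [Finsupp.linearCombination_apply]
  rw [← Finsupp.sum_add]
  refine Finsupp.sum_congr fun e he => ?_
  rw [extend_add_gaugeShift σ φ (hγ he), Pi.add_apply, smul_add]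

lemma phi_sq (r : ℝ) (z : ZMod n) : phi ρ r z ^ 2 = Real.exp (2 * r * ((ρ z : ℂ).re - 1)) := by
  rw [phi, ← Real.exp_nat_mul]
  congr 1
  simp
  ring

lemma phi_sq_zero (r : ℝ) : phi ρ r 0 ^ 2 = 1 := by
  simp [phi_sq]

lemma phi_sq_le_one {r : ℝ} (hr : 0 ≤ r) (z : ZMod n) : phi ρ r z ^ 2 ≤ 1 := by
  rw [phi_sq, Real.exp_le_one_iff]
  have h1 : (ρ z : ℂ).re ≤ 1 := by
    simpa only [Circle.norm_coe] using Complex.re_le_norm (ρ z : ℂ)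
  exact mul_nonpos_of_nonneg_of_nonpos (by positivity) (by linarith)

lemma sum_units_re (z : ZMod n) : ∑ s : ℤˣ, ((ρ ((s : ℤ) • z) : ℂ)).re = 2 * (ρ z : ℂ).re := by
  have h : (Finset.univ : Finset ℤˣ) = {1, -1} := by decide
  rw [h, Finset.sum_pair (by decide)]
  simp [AddChar.map_neg_eq_inv]
  ring

lemma neg_action_re (b κ : ℝ) (σ : Form n (edges N)) (φ : Form n (box N)) :
    -(action ρ N b κ σ φ).re = 2 * b * ∑ p : plaqs N, (ρ (dOne σ p) : ℂ).re +
      2 * κ * ∑ e : edges N, (ρ (σ e - φ.onChain (edgeBoundary e)) : ℂ).re := by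
  simp only [action, Complex.sub_re, Complex.mul_re, Complex.neg_re, Complex.neg_im,
    Complex.ofReal_re, Complex.ofReal_im, Complex.re_sum, Fintype.sum_prod_type, sum_units_re]
  simp only [← Finset.mul_sum]
  ring

/-- The Boltzmann factor at the trivial configuration. -/
def trivialWeight (N : ℕ) (b κ : ℝ) : ℝ :=
  Real.exp (2 * b * Fintype.card (plaqs N) + 2 * κ * Fintype.card (edges N))

/-- Up to a constant, the Boltzmann factor of a gauge transformed field is a product of plaquette
and edge factors not involving the Higgs field. -/
lemma exp_neg_action_re (b κ : ℝ) (σ : Form n (edges N)) (φ : Form n (box N)) :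
    Real.exp (-(action ρ N b κ (σ + gaugeShift φ) φ).re) = trivialWeight N b κ *
      ((∏ p : plaqs N, phi ρ b (dOne σ p) ^ 2) * ∏ e, phi ρ κ (σ e) ^ 2) := by
  have h1 : ∀ e : edges N, (σ + gaugeShift φ) e - φ.onChain (edgeBoundary e) = σ e := by
    intro e
    rw [onChain_edgeBoundary, Pi.add_apply, gaugeShift, add_sub_cancel_right]
  simp only [neg_action_re, dOne_add_gaugeShift, h1, phi_sq, ← Real.exp_sum, trivialWeight,
    ← Real.exp_add]
  congr 1
  simp only [← Finset.mul_sum, Finset.sum_sub_distrib, Finset.sum_const, Finset.card_univ,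
    nsmul_eq_mul, mul_one]
  ring

lemma gibbsWeight_self_eq (f g : ZMod n → ℝ) (σ : Form n (edges N)) :
    gibbsWeight N N f g σ = (∏ p : plaqs N, f (dOne σ p)) * ∏ e, g (σ e) := by
  rw [gibbsWeight]
  congr 1
  · rw [← Finset.prod_coe_sort (plaqs N) fun p => f (curlAt (extend σ) p)]
    exact Finset.prod_congr rfl fun p _ => by rw [dOne_apply]
  · exact Finset.prod_congr rfl fun e _ => if_pos e.2

lemma weight_coe_add_gaugeShift (β κ : ℝ) (σ : Form n (edges N)) (φ : Form n (box N)) :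
    weight ρ N (β : WithTop ℝ) κ (σ + gaugeShift φ) φ = trivialWeight N β κ *
      gibbsWeight N N (fun z => phi ρ β z ^ 2) (fun z => phi ρ κ z ^ 2) σ := by
  rw [gibbsWeight_self_eq, ← exp_neg_action_re]
  rfl

lemma weight_top_add_gaugeShift (κ : ℝ) (σ : Form n (edges N)) (φ : Form n (box N)) :
    weight ρ N ⊤ κ (σ + gaugeShift φ) φ = trivialWeight N 0 κ *
      gibbsWeight N N (fun z => if z = 0 then 1 else 0) (fun z => phi ρ κ z ^ 2) σ := by
  rw [gibbsWeight_self_eq]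
  change (if dOne (σ + gaugeShift φ) = 0 then
    Real.exp (-(action ρ N 0 κ (σ + gaugeShift φ) φ).re) else 0) = _
  rw [dOne_add_gaugeShift, exp_neg_action_re]
  split_ifs with h
  · have h1 : ∀ z, phi ρ 0 z ^ 2 = 1 := fun z => by simp [phi]
    simp [h, h1]
  · obtain ⟨p, hp⟩ := Function.ne_iff.1 h
    rw [Finset.prod_eq_zero (Finset.mem_univ p) (if_neg hp)]
    simp

variable [NeZero n]

/-- If the weight in a gauge transformed field does not depend on the Higgs field, then the Higgs
field can be summed out. -/
lemma expectation_eq_gibbsExp {β : WithTop ℝ} {κ c : ℝ} (hc : c ≠ 0) {W : Form n (edges N) → ℝ}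
    (hW : ∀ σ φ, weight ρ N β κ (σ + gaugeShift φ) φ = c * W σ) {γ : PosEdge →₀ ℤ}
    (hγ : γ.support ⊆ edges N) :
    expectation ρ N β κ (wilsonLine ρ γ N) = gibbsExp W fun τ => wilson ρ γ (extend τ) := by
  have key : ∀ (F : Form n (edges N) → Form n (box N) → ℂ) (h : Form n (edges N) → ℂ),
      (∀ σ φ, F (σ + gaugeShift φ) φ = h σ) →
      ∑ σ, ∑ φ, (weight ρ N β κ σ φ : ℂ) * F σ φ =
        (Fintype.card (Form n (box N)) * c : ℂ) * ∑ σ, (W σ : ℂ) * h σ := by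
    intro F h hF
    rw [Finset.sum_comm]
    have : ∀ φ : Form n (box N), ∑ σ, (weight ρ N β κ σ φ : ℂ) * F σ φ =
        c * ∑ σ, (W σ : ℂ) * h σ := by
      intro φ
      rw [← Equiv.sum_comp (Equiv.addRight (gaugeShift φ)), Finset.mul_sum]
      refine Finset.sum_congr rfl fun σ _ => ?_
      rw [Equiv.coe_addRight, hF, hW]
      push_cast
      ring
    rw [Finset.sum_congr rfl fun φ _ => this φ, Finset.sum_const, Finset.card_univ, nsmul_eq_mul,
      mul_assoc]
  have h1 := key (wilsonLine ρ γ N) _ fun σ φ => wilsonLine_add_gaugeShift ρ hγ σ φ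
  have h2 := key (fun _ _ => 1) (fun _ => 1) fun _ _ => rfl
  simp only [mul_one] at h2
  rw [expectation, gibbsExp, h1]
  push_cast
  rw [h2, mul_div_mul_left]
  have : (Fintype.card (Form n (box N)) : ℂ) ≠ 0 := by exact_mod_cast Fintype.card_ne_zero
  exact mul_ne_zero this (by exact_mod_cast hc)

end Weights

end Gauge

/-! ### The infinite volume limit -/

section Limit

variable {n : ℕ} (ρ : AddChar (ZMod n) Circle)

lemma isFactorPair_phi {β : ℝ} (hβ : 0 ≤ β) (κ : ℝ) :
    IsFactorPair (fun z => phi ρ β z ^ 2) fun z => phi ρ κ z ^ 2 where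
  f_zero := phi_sq_zero ρ β
  f_nonneg _ := sq_nonneg _
  f_le_one := phi_sq_le_one ρ hβ
  g_zero := phi_sq_zero ρ κ
  g_nonneg _ := sq_nonneg _

lemma isFactorPair_closed (κ : ℝ) :
    IsFactorPair (fun z : ZMod n => if z = 0 then 1 else 0) fun z => phi ρ κ z ^ 2 where
  f_zero := if_pos rfl
  f_nonneg _ := by split_ifs <;> norm_num
  f_le_one _ := by split_ifs <;> norm_num
  g_zero := phi_sq_zero ρ κ
  g_nonneg _ := sq_nonneg _

lemma alpha1_nonneg (β : ℝ) : 0 ≤ alpha1 ρ β := Real.iSup_nonneg fun _ => sq_nonneg _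

lemma alpha1_le_one {β : ℝ} (hβ : 0 ≤ β) : alpha1 ρ β ≤ 1 :=
  Real.iSup_le (fun z => phi_sq_le_one ρ hβ z.1) zero_le_one

lemma edgeNorm_add_le_of_mem_support {γ : PosEdge →₀ ℤ} (k : ℕ) :
    ∀ e ∈ γ.support, edgeNorm e + k + 2 ≤ k + (γ.support.sup edgeNorm + 2) := by
  intro e he
  have : edgeNorm e ≤ γ.support.sup edgeNorm := Finset.le_sup he
  omega

variable [NeZero n]

lemma alpha0_nonneg (κ : ℝ) : 0 ≤ alpha0 ρ κ := Finset.sum_nonneg fun _ _ => sq_nonneg _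

lemma phi_sq_le_alpha1 (β : ℝ) {z : ZMod n} (hz : z ≠ 0) : phi ρ β z ^ 2 ≤ alpha1 ρ β :=
  le_ciSup (f := fun z : {z : ZMod n // z ≠ 0} => phi ρ β z ^ 2) (Set.finite_range _).bddAbove
    ⟨z, hz⟩

/-- The expectations on boxes form a Cauchy sequence, since enlarging the box hardly changes them.
The index is shifted so that the edges of `γ` have distance more than `k` from the complement of
the `k`-th box. -/
lemma exists_tendsto_gibbsExp {f g : ZMod n → ℝ} (h : IsFactorPair f g) {y : ℝ}
    (hy : (∑ z ∈ (Finset.univ : Finset (ZMod n)).erase 0, g z) *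
      (2 + ∑ z ∈ (Finset.univ : Finset (ZMod n)).erase 0, g z) = y) (hy0 : 0 ≤ y)
    (hy1 : 96 * y < 1) (γ : PosEdge →₀ ℤ) :
    ∃ ℓ, Tendsto (fun N => gibbsExp (gibbsWeight N N f g) fun τ => wilson ρ γ (extend τ))
      atTop (𝓝 ℓ) := by
  set E : ℕ → ℂ := fun N => gibbsExp (gibbsWeight N N f g) fun τ => wilson ρ γ (extend τ)
  set D := γ.support.sup edgeNorm + 2
  have hC : CauchySeq fun k => E (k + D) := by
    refine cauchySeq_of_le_tendsto_0' (fun k => 2 * γ.support.card * (96 * y) ^ k) ?_ ?_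
    · intro k m hkm
      have hle : k + D ≤ m + D := by omega
      rw [dist_eq_norm]
      simp only [E]
      rw [← gibbsExp_gibbsWeight_eq hle]
      exact norm_gibbsExp_box_sub_le h hle hy hy1.le (fun x x' hx => wilson_congr ρ hx)
        (norm_wilson ρ γ) (edgeNorm_add_le_of_mem_support k)
    · simpa using (tendsto_pow_atTop_nhds_zero_of_lt_one (by positivity) hy1).const_mul
        (2 * (γ.support.card : ℝ))
  obtain ⟨ℓ, hℓ⟩ := cauchySeq_tendsto_of_complete hC
  exact ⟨ℓ, (tendsto_add_atTop_iff_nat D).1 hℓ⟩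

lemma isWilsonLineExpectation_of_tendsto {β : WithTop ℝ} {κ : ℝ} {f g : ZMod n → ℝ} {c : ℕ → ℝ}
    (hc : ∀ N, c N ≠ 0) {γ : PosEdge →₀ ℤ} (hW : ∀ N (σ : Form n (edges N)) φ,
      weight ρ N β κ (σ + gaugeShift φ) φ = c N * gibbsWeight N N f g σ) {ℓ : ℂ}
    (hℓ : Tendsto (fun N => gibbsExp (gibbsWeight N N f g) fun τ => wilson ρ γ (extend τ))
      atTop (𝓝 ℓ)) : IsWilsonLineExpectation ρ β κ γ ℓ := by
  refine hℓ.congr' ?_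
  filter_upwards [eventually_ge_atTop (γ.support.sup edgeNorm + 2)] with N hN
  refine (expectation_eq_gibbsExp ρ (hc N) (hW N) fun e he => ?_).symm
  have : edgeNorm e ≤ γ.support.sup edgeNorm := Finset.le_sup he
  exact mem_edges_of_edgeNorm_le (by omega)

end Limit

end LatticeHiggs

end

theorem mainTheorem4 (n : ℕ) [NeZero n] (hn : 2 ≤ n)
    (ρ : AddChar (ZMod n) Circle) (hρ : Function.Injective ρ)
    (β κ : ℝ) (hβ : 0 ≤ β) (hκ : 0 ≤ κ)
    (hA : 18 ^ 2 * LatticeHiggs.alpha0 ρ κ * (2 + LatticeHiggs.alpha0 ρ κ) < 1)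
    (γ : LatticeHiggs.PosEdge →₀ ℤ) (hγ : LatticeHiggs.IsPath γ) :
    ∃ ℓ ℓ' : ℂ,
      LatticeHiggs.IsWilsonLineExpectation ρ (β : WithTop ℝ) κ γ ℓ ∧
      LatticeHiggs.IsWilsonLineExpectation ρ ⊤ κ γ ℓ' ∧
      ‖ℓ - ℓ'‖ ≤ 2 * LatticeHiggs.constK' ρ κ *
        (1 + LatticeHiggs.constK ρ κ * LatticeHiggs.constK' ρ κ * LatticeHiggs.alpha0 ρ κ) *
        (γ.support.card : ℝ) * LatticeHiggs.alpha0 ρ κ * LatticeHiggs.alpha1 ρ β ^ 6 := by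
  open LatticeHiggs in
  have ha0 := alpha0_nonneg ρ κ
  have hα0 := alpha1_nonneg ρ β
  set a := alpha0 ρ κ with ha
  set α := alpha1 ρ β
  set y := a * (2 + a) with hy
  have hy0 : 0 ≤ y := by positivity
  have hy1 : 96 * y < 1 := by linarith
  have hβf := isFactorPair_phi ρ hβ κ
  obtain ⟨ℓ, hℓ⟩ := exists_tendsto_gibbsExp ρ hβf hy.symm hy0 hy1 γ
  obtain ⟨ℓ', hℓ'⟩ := exists_tendsto_gibbsExp ρ (isFactorPair_closed ρ κ) hy.symm hy0 hy1 γ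
  refine ⟨ℓ, ℓ', isWilsonLineExpectation_of_tendsto ρ (fun N => (Real.exp_pos _).ne')
    (fun N => weight_coe_add_gaugeShift ρ β κ) hℓ, isWilsonLineExpectation_of_tendsto ρ
    (fun N => (Real.exp_pos _).ne') (fun N => weight_top_add_gaugeShift ρ κ) hℓ', ?_⟩
  have hlim : ‖ℓ - ℓ'‖ ≤ 2 * γ.support.card * (α ^ 6 * (96 * y) + 0) := by
    set D := γ.support.sup edgeNorm + 2
    refine le_of_tendsto_of_tendsto' ((tendsto_add_atTop_iff_nat D).2 (hℓ.sub hℓ').norm)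
      (((tendsto_pow_atTop_nhds_zero_of_lt_one (by positivity) hy1).const_add
        (α ^ 6 * (96 * y))).const_mul (2 * (γ.support.card : ℝ))) fun k => ?_
    exact norm_gibbsExp_sub_closed_le hβf hα0 (alpha1_le_one ρ hβ)
      (fun z hz => phi_sq_le_alpha1 ρ β hz) hy.symm hy1.le (fun x x' hx => wilson_congr ρ hx)
      (norm_wilson ρ γ) (edgeNorm_add_le_of_mem_support k)
  have hK' : constK' ρ κ * a = 324 * y := by
    rw [constK', ← ha, hy]
    ring
  have hK : 0 ≤ constK ρ κ := by
    have : 0 < 1 - 18 ^ 2 * (2 + a) * a := by linarith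
    rw [constK, ← ha]
    positivity
  -- Since `K' α₀ = 324 y`, the constant `96` from the percolation count leaves room to spare, and
  -- the term with `K` only enters through its sign.
  calc ‖ℓ - ℓ'‖ ≤ 2 * γ.support.card * α ^ 6 * (96 * y) := by linarith
    _ ≤ 2 * γ.support.card * α ^ 6 * (324 * y * (1 + constK ρ κ * (324 * y))) := by
        have : 0 ≤ constK ρ κ * (324 * y) := by positivity
        refine mul_le_mul_of_nonneg_left ?_ (by positivity)
        nlinarith
    _ = _ := by
        rw [← hK']
        ring
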